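/- **Setting.** Let $V$ and $Z$ be random elements with values in measurable spaces $\mathcal V$ and $\mathcal Z$ (e.g. closed Euclidean sets), let $f_*:\mathcal Z\to\mathbb R$, and let $\mathcal H$ be a real reproducing kernel Hilbert space of functions on $\mathcal Z$ with kernel $k$. Write $\|f\|_Z=\mathbb E[f(Z)^2]^{1/2}$ and let $L^2(Z)$ be the corresponding space. Assume: - (A1) $f_*\in L^2(Z)$. - (A2) $\mathcal H\subset L^2(Z)$, $\mathcal H$ is separable, $k$ is symmetric and $k\le\kappa^2$ for some $\kappa>0$. - (A3) There is a linear operator $\mathcal T:L^2(Z)\to L^1(V)$ with $\mathbb E[f(Z)f_*(Z)]=\mathbb E[\mathcal Tf(V)]$ for all $f\in L^2(Z)$. - (A4) There are functions $\mathcal T_2k(\cdot,v)\in\mathcal H$, $v\in\mathcal V$, such that for every $z\in\mathcal Z$ the function $v\mapsto \mathcal T_2k(z,v)$ is a version of $\mathcal T[k(z,\cdot)]$, and $\|\mathcal T_2k(\cdot,v)\|_{\mathcal H}\le C$ for all $v\in\mathcal V$ and some $C>0$. Let $\mathcal L f(z)=\mathbb E[k(z,Z)f(Z)]$, which is a bounded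 operator $L^2(Z)\to\mathcal H$ and, by restriction, a compact self-adjoint operator on $\mathcal H$ with eigenvalues in $[0,\kappa^2]$. For a compact self-adjoint operator $A$ on $\mathcal H$ with eigenvalues in $[0,\kappa^2]$ and a bounded $\phi:[0,\kappa^2]\to\mathbb R$, let $\phi(A)f=\sum_\sigma\phi(\sigma)P_\sigma f$, the sum running over all eigenvalues $\sigma$ of $A$ (including $0$ if it is one), where $P_\sigma$ is the orthogonal projection onto the eigenspace of $\sigma$. Let $f_{\mathcal H}$ be the minimal norm solution of $\inf_{f\in\mathcal H}\|f-f_*\|_Z$, and assume: - (A5) there are $r>0$ and $u\in\mathcal H$ such that $f_{\mathcal H}$ exists and $f_{\mathcal H}=\mathcal L^ru$. A *regulariser* is a family $g_\lambda:[0,\kappa^2]\to\mathbb R$, $0<\lambda\le\kappa^2$, for which there are $B,D,\gamma>0$ with $|\sigma g_\lambda(\sigma)|\le D$ and $|1-\sigma g_\lambda(\sigma)|\le\gamma$ for all $0<\sigma\le\kappa^2$ and $|g_\lambda(\sigma)|\le B/\lambda$ for all $0\le\sigma\le\kappa^2$, for every $0<\lambda\le\kappa^2$. Its *qualification* $\bar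 r$ is the maximal $\nu>0$ for which there is $\gamma_\nu>0$ with $|1-\sigma g_\lambda(\sigma)|\sigma^\nu\le\gamma_\nu\lambda^\nu$ for all $0<\sigma\le\kappa^2$ and $\lambda\in(0,\kappa^2)$; it is $\infty$ if every $\nu>0$ has this property. Let $v_1,\dots,v_n$ ($n\ge1$) be i.i.d. copies of $V$, and let $m\ge1$. Consider either of the following settings, where the $z_i$ need not be independent of the $v_i$: - (S1) $n_z=m$ and $z_1,\dots,z_{n_z}$ are i.i.d. copies of $Z$; - (S2) $Z=(X,U)$ with $X$ and $U$ independent, $x_1,\dots,x_n$ are i.i.d. copies of $X$ and $u_1,\dots,u_m$ are i.i.d. copies of $U$, the two samples being independent of each other, and $z_i=(x_{\lceil i/m\rceil},u_{i-m\lfloor (i-1)/m\rfloor})$ for $i=1,\dots,n_z$ with $n_z=nm$. Let $\hat{\mathcal L}f=\frac1{n_z}\sum_{i=1}^{n_z}f(z_i)k(\cdot,z_i)$ on $\mathcal H$, $\hat b=\frac1n\sum_{i=1}^n\mathcal T_2k(\cdot,v_i)$ and $\hat f_\lambda=g_\lambda(\hat{\mathcal L})\hat b$. **Theorem.** There are constants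 $C_1,C_2$, not depending on $n$, $m$ and $\eta$, such that the following holds in both settings for all $n,m\ge1$ and $\eta\in(0,1)$. Let $\lambda=(n^{-1/2}+m^{-1/2})^{1/(r+1)}$ and assume that $\lambda\le\kappa^2$ and $\lambda^{-r}>6\kappa^2\log(4/\eta)$. Then, with probability at least $1-\eta$, if $r\le\bar r$ it holds $$\|\hat f_\lambda-f_{\mathcal H}\|_{\mathcal H}\le C_1\left(\frac1{\sqrt n}+\frac1{\sqrt m}\right)^{\frac r{r+1}}\log\left(\frac4\eta\right),$$ and if $r\le\bar r-1/2$ it holds $$\|\hat f_\lambda-f_{\mathcal H}\|_{Z}\le C_2\left(\frac1{\sqrt n}+\frac1{\sqrt m}\right)^{\frac{2r+1}{2r+2}}\log\left(\frac4\eta\right).$$ -/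

import Mathlib

open MeasureTheory ProbabilityTheory

noncomputable section

/-- The scalar kernel `k : 𝓩 × 𝓩 → ℝ` of a real reproducing kernel Hilbert space. -/
def scalarKernel {𝓩 : Type*} (H : Type*) [NormedAddCommGroup H] [InnerProductSpace ℝ H]
    [CompleteSpace H] [RKHS ℝ H 𝓩 ℝ] (z z' : 𝓩) : ℝ :=
  RKHS.kernel H z z' 1

/-- The kernel section `k(·, z)`, as an element of `H`. -/
def kernelSection {𝓩 : Type*} (H : Type*) [NormedAddCommGroup H] [InnerProductSpace ℝ H]
    [CompleteSpace H] [RKHS ℝ H 𝓩 ℝ] (z : 𝓩) : H :=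
  RKHS.kerFun H z 1

theorem kernelSection_apply {𝓩 : Type*} (H : Type*) [NormedAddCommGroup H]
    [InnerProductSpace ℝ H] [CompleteSpace H] [RKHS ℝ H 𝓩 ℝ] (z z' : 𝓩) :
    kernelSection H z z' = scalarKernel H z' z :=
  RKHS.kerFun_apply H z 1 z'

theorem inner_kernelSection {𝓩 : Type*} {H : Type*} [NormedAddCommGroup H]
    [InnerProductSpace ℝ H] [CompleteSpace H] [RKHS ℝ H 𝓩 ℝ] (z : 𝓩) (f : H) :
    inner ℝ (kernelSection H z) f = f z := by
  simp [kernelSection]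

/-- The standing assumption on the RKHS `H`, where `μ` is the law of `Z`: `H ⊆ L²(Z)`, `H` is
separable, and the kernel is symmetric and bounded above by `κ²` for some `κ > 0`. -/
structure BoundedKernel {𝓩 : Type*} [MeasurableSpace 𝓩] (H : Type*) [NormedAddCommGroup H]
    [InnerProductSpace ℝ H] [CompleteSpace H] [RKHS ℝ H 𝓩 ℝ] (μ : Measure 𝓩) (κ : ℝ) :
    Prop where
  memLp : ∀ f : H, MemLp (fun z => f z) 2 μ
  separable : TopologicalSpace.SeparableSpace H
  symm : ∀ z z' : 𝓩, scalarKernel H z z' = scalarKernel H z' z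
  pos : 0 < κ
  le : ∀ z z' : 𝓩, scalarKernel H z z' ≤ κ ^ 2

namespace BoundedKernel

variable {𝓩 : Type*} [MeasurableSpace 𝓩] {H : Type*} [NormedAddCommGroup H]
  [InnerProductSpace ℝ H] [CompleteSpace H] [RKHS ℝ H 𝓩 ℝ] {μ : Measure 𝓩} {κ : ℝ}

theorem norm_apply_le (h : BoundedKernel H μ κ) (f : H) (z : 𝓩) : ‖f z‖ ≤ κ * ‖f‖ := by
  have h1 : ‖kernelSection H z‖ ≤ κ := by
    have h2 : ‖kernelSection H z‖ ^ 2 ≤ κ ^ 2 := by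
      rw [← real_inner_self_eq_norm_sq, inner_kernelSection, kernelSection_apply]
      exact h.le z z
    exact le_of_sq_le_sq h2 h.pos.le
  rw [← inner_kernelSection]
  exact (norm_inner_le_norm _ _).trans (mul_le_mul_of_nonneg_right h1 (norm_nonneg _))

theorem norm_toLp_le [IsProbabilityMeasure μ] (h : BoundedKernel H μ κ) (f : H) :
    ‖(h.memLp f).toLp (fun z => f z)‖ ≤ κ * ‖f‖ := by
  have h1 : ∀ᵐ z ∂μ, ‖(h.memLp f).toLp (fun z => f z) z‖ ≤ κ * ‖f‖ := by
    filter_upwards [(h.memLp f).coeFn_toLp] with z hz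
    rw [hz]
    exact h.norm_apply_le f z
  have h2 := Lp.norm_le_of_ae_bound (mul_nonneg h.pos.le (norm_nonneg f)) h1
  have h3 : measureUnivNNReal μ = 1 := by simp [measureUnivNNReal]
  rwa [h3, NNReal.coe_one, Real.one_rpow, one_mul] at h2

/-- The inclusion operator `I_k : H → L²(Z)`. -/
def inclusion [IsProbabilityMeasure μ] (h : BoundedKernel H μ κ) : H →L[ℝ] Lp ℝ 2 μ :=
  LinearMap.mkContinuous
    { toFun := fun f => (h.memLp f).toLp (fun z => f z)
      map_add' := fun f f' => by
        rw [← MemLp.toLp_add (h.memLp f) (h.memLp f')]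
        exact MemLp.toLp_congr _ _ (Filter.Eventually.of_forall fun z => by simp)
      map_smul' := fun c f => by
        rw [RingHom.id_apply, ← MemLp.toLp_const_smul c (h.memLp f)]
        exact MemLp.toLp_congr _ _ (Filter.Eventually.of_forall fun z => by simp) }
    κ h.norm_toLp_le

theorem inclusion_ae [IsProbabilityMeasure μ] (h : BoundedKernel H μ κ) (f : H) :
    h.inclusion f =ᵐ[μ] fun z => f z :=
  (h.memLp f).coeFn_toLp

/-- The kernel operator `𝓛 : L²(Z) → H`, as the adjoint of the inclusion; by
`kernelOperator_apply`, `𝓛 f (z) = E[k(z, Z) f(Z)]`. -/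
def kernelOperator [IsProbabilityMeasure μ] (h : BoundedKernel H μ κ) : Lp ℝ 2 μ →L[ℝ] H :=
  ContinuousLinearMap.adjoint h.inclusion

theorem kernelOperator_apply [IsProbabilityMeasure μ] (h : BoundedKernel H μ κ)
    (f : Lp ℝ 2 μ) (z : 𝓩) :
    h.kernelOperator f z = ∫ z', scalarKernel H z z' * f z' ∂μ := by
  rw [← inner_kernelSection, kernelOperator, ContinuousLinearMap.adjoint_inner_right,
    L2.inner_def]
  refine integral_congr_ae ((h.inclusion_ae (kernelSection H z)).mono fun z' hz' => ?_)
  simp only [hz', kernelSection_apply, h.symm z' z]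
  simp [mul_comm]

/-- The kernel operator as an operator `𝓛 = 𝓛 I_k` on `H`. -/
def kernelOperatorH [IsProbabilityMeasure μ] (h : BoundedKernel H μ κ) : H →L[ℝ] H :=
  h.kernelOperator ∘L h.inclusion

end BoundedKernel

/-- Spectral calculus for a compact self-adjoint operator `A`:
`φ(A) f = ∑_σ φ(σ) P_σ f`, where `P_σ` is the orthogonal projection on `ker (A - σ)`. Only the
eigenvalues `σ` of `A` (zero included, if it is one) contribute to the sum. -/
def spectralApply {H : Type*} [NormedAddCommGroup H] [InnerProductSpace ℝ H] [CompleteSpace H]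
    (A : H →L[ℝ] H) (φ : ℝ → ℝ) (f : H) : H :=
  ∑' σ : ℝ, φ σ • (A - σ • ContinuousLinearMap.id ℝ H).ker.starProjection f

/-- `f` is the minimal norm solution of `inf_f ‖I f - y‖`. -/
def IsMinNormSolution {H E : Type*} [NormedAddCommGroup H] [NormedSpace ℝ H]
    [NormedAddCommGroup E] [NormedSpace ℝ E] (I : H →L[ℝ] E) (y : E) (f : H) : Prop :=
  (∀ f' : H, ‖I f - y‖ ≤ ‖I f' - y‖) ∧
    ∀ f' : H, (∀ f'' : H, ‖I f' - y‖ ≤ ‖I f'' - y‖) → ‖f‖ ≤ ‖f'‖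

/-- `g lam σ` is a regulariser (filter function) on `[0, κ²]`. The bound by `B / lam` is also
required at `σ = 0`, where `g lam` acts on the kernel of the operator; at `σ = 0` the two other
bounds carry no information. -/
def IsRegulariser (κ : ℝ) (g : ℝ → ℝ → ℝ) : Prop :=
  ∃ B D γ : ℝ, 0 < B ∧ 0 < D ∧ 0 < γ ∧ ∀ lam : ℝ, 0 < lam → lam ≤ κ ^ 2 →
    (∀ σ : ℝ, 0 < σ → σ ≤ κ ^ 2 → |σ * g lam σ| ≤ D) ∧
    (∀ σ : ℝ, 0 ≤ σ → σ ≤ κ ^ 2 → |g lam σ| ≤ B / lam) ∧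
    (∀ σ : ℝ, 0 < σ → σ ≤ κ ^ 2 → |1 - σ * g lam σ| ≤ γ)

/-- The qualification inequality of order `ν`. -/
def QualifiesAt (κ : ℝ) (g : ℝ → ℝ → ℝ) (ν : ℝ) : Prop :=
  ∃ γν : ℝ, 0 < γν ∧ ∀ lam : ℝ, 0 < lam → lam < κ ^ 2 →
    ∀ σ : ℝ, 0 < σ → σ ≤ κ ^ 2 → |1 - σ * g lam σ| * σ ^ ν ≤ γν * lam ^ ν

/-- `rbar` is the qualification of `g`: the maximal order `ν > 0` of a qualification inequality,
or `∞` if all orders are possible. -/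
def IsQualification (κ : ℝ) (g : ℝ → ℝ → ℝ) (rbar : EReal) : Prop :=
  (∃ ν : ℝ, rbar = (ν : EReal) ∧ IsGreatest {ν' : ℝ | 0 < ν' ∧ QualifiesAt κ g ν'} ν) ∨
    (rbar = ⊤ ∧ ∀ ν : ℝ, 0 < ν → QualifiesAt κ g ν)

/-- `x` is a finite i.i.d. sample of the law `μ` on the probability space `(Ω, P)`. -/
def IsIIDSample {Ω E : Type*} [MeasurableSpace Ω] [MeasurableSpace E] (P : Measure Ω)
    (μ : Measure E) {n : ℕ} (x : Fin n → Ω → E) : Prop :=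
  (∀ i, Measurable (x i)) ∧ (∀ i, P.map (x i) = μ) ∧ iIndepFun x P

/-- The points `z_i = (x_{⌈i / m⌉}, u_{i - m ⌊(i - 1) / m⌋})`, `i = 1, …, nm` (here with indices
starting at `0`), where `pair x u` is the point `(x, u)` of `𝓩`. -/
def productSample {𝓧 𝓤 𝓩 : Type*} {n m : ℕ} (pair : 𝓧 × 𝓤 → 𝓩) (x : Fin n → 𝓧)
    (u : Fin m → 𝓤) : Fin (n * m) → 𝓩 :=
  fun i => pair (x i.divNat, u i.modNat)

/-- The empirical kernel operator `f ↦ N⁻¹ ∑ i, f(z_i) k(·, z_i)` on `H`. -/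
def empiricalOperator {𝓩 : Type*} (H : Type*) [NormedAddCommGroup H] [InnerProductSpace ℝ H]
    [CompleteSpace H] [RKHS ℝ H 𝓩 ℝ] {N : ℕ} (z : Fin N → 𝓩) : H →L[ℝ] H :=
  (N : ℝ)⁻¹ • ∑ i, (innerSL ℝ (kernelSection H (z i))).smulRight (kernelSection H (z i))

theorem empiricalOperator_apply {𝓩 : Type*} {H : Type*} [NormedAddCommGroup H]
    [InnerProductSpace ℝ H] [CompleteSpace H] [RKHS ℝ H 𝓩 ℝ] {N : ℕ} (z : Fin N → 𝓩) (f : H) :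
    empiricalOperator H z f = (N : ℝ)⁻¹ • ∑ i, f (z i) • kernelSection H (z i) := by
  simp [empiricalOperator, inner_kernelSection]

/-- The estimator `g_lam(𝓛̂) b̂`, with `b̂ = n⁻¹ ∑ i, 𝓣₂k(·, v_i)`. -/
def grsEstimator {𝓥 𝓩 H : Type*} [NormedAddCommGroup H] [InnerProductSpace ℝ H]
    [CompleteSpace H] [RKHS ℝ H 𝓩 ℝ] (g : ℝ → ℝ → ℝ) (T₂k : 𝓥 → H) (lam : ℝ) {n N : ℕ}
    (v : Fin n → 𝓥) (z : Fin N → 𝓩) : H :=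
  spectralApply (empiricalOperator H z) (g lam) ((n : ℝ)⁻¹ • ∑ i, T₂k (v i))

/-- The property `Q` holds with probability at least `p`: it holds on a measurable event of
probability at least `p`. -/
def WithProbAtLeast {Ω : Type*} [MeasurableSpace Ω] (P : Measure Ω) (p : ℝ) (Q : Ω → Prop) :
    Prop :=
  ∃ E : Set Ω, MeasurableSet E ∧ ENNReal.ofReal p ≤ P E ∧ ∀ ω ∈ E, Q ω

/-- The two error bounds for an estimate `fhat` of `fH`: in the norm of `H` when `r ≤ rbar`, and
in the norm of `L²(Z)` when `r ≤ rbar - 1/2`. -/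
def ErrorBounds {H E : Type*} [NormedAddCommGroup H] [NormedSpace ℝ H]
    [NormedAddCommGroup E] [NormedSpace ℝ E] (I : H →L[ℝ] E) (r : ℝ) (rbar : EReal)
    (C₁ C₂ : ℝ) (n m : ℕ) (η : ℝ) (fhat fH : H) : Prop :=
  ((r : EReal) ≤ rbar →
    ‖fhat - fH‖ ≤ C₁ * (1 / √(n : ℝ) + 1 / √(m : ℝ)) ^ (r / (r + 1)) * Real.log (4 / η)) ∧
  (((r + 1 / 2 : ℝ) : EReal) ≤ rbar →
    ‖I (fhat - fH)‖ ≤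
      C₂ * (1 / √(n : ℝ) + 1 / √(m : ℝ)) ^ ((2 * r + 1) / (2 * r + 2)) * Real.log (4 / η))

end

/-! Write `t = 1 / √n + 1 / √m`, so that `lam ^ (r + 1) = t`, and let `ℓ = log (4 / η)`, `L = 𝓛`, `A
= 𝓛̂`, `f = f_H`. Outside an event of probability at most `η`, both `A - L` and `b̂ - L f` have norm
at most a constant times `t ℓ`; everything else is deterministic.

The source condition `f = L ^ r w` invites a comparison of `A ^ r` with `L ^ r`, but powers `r < 1`
are not operator Lipschitz. They are replaced by a polynomial `F`, depending on `lam`, which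
dominates `σ ^ r`, is dominated by `σ ^ r + lam ^ r`, and has operator Lipschitz constant of order
`1 / lam` (`exists_polynomial_power`). It is a sum over dyadic scales of `2 ^ (-r j) (1 - (1 - x) ^
(2 ^ j)) ^ p` with `p > r` and `x = σ / M`, stopped where `2 ^ J` is about `M / lam`. Then `f = F(L)
u` with `‖u‖` bounded uniformly in `lam`, and with `q(σ) = 1 - σ g(σ)` `g(A) b̂ - f = g(A) (b̂ - A
f) - (q F)(A) u + q(A) (F(A) u - f)` (`spectralApply_sub_eq`). In the first and last terms a factor
`1 / lam` meets a deviation of order `lam ^ (r + 1) ℓ`; the middle one is `O(lam ^ r)` by the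
qualification. For the `L²` norm, `‖I h‖² = ⟨L h, h⟩ ≤ ⟨A h, h⟩ + ‖A - L‖ ‖h‖²`, and the assumption
on `lam ^ (-r)` makes `‖A - L‖ ≤ lam`, so every term gains `√lam`.

For the probabilistic part, `A - L` is dominated by the deviation of an empirical mean of tensor
squares `k_z ⊗ k_z` in a Hilbert space. Means of bounded i.i.d. vectors are sub-Gaussian, by
induction on the exponential moment of the squared norm of the sum (`lintegral_exp_norm_sum_sq_le`).
On the grid of (S2) this is applied twice: to the `u_j` with the `x_i` fixed, and to the `x_i` after
integrating out `u`. -/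

/-! ### Spectral series of positive bounded operators. -/

/-- `A` is symmetric and `A² ≤ M A` as quadratic forms, so that its eigenvalues lie in `[0, M]`. -/
structure IsPosBounded {H : Type*} [NormedAddCommGroup H] [InnerProductSpace ℝ H]
    (A : H →L[ℝ] H) (M : ℝ) : Prop where
  symm : ∀ x y, inner ℝ (A x) y = inner ℝ x (A y)
  sq_le : ∀ x, ‖A x‖ ^ 2 ≤ M * inner ℝ (A x) x

namespace IsPosBounded

variable {H : Type*} [NormedAddCommGroup H] [InnerProductSpace ℝ H] {A : H →L[ℝ] H} {M : ℝ}

/-- On an eigenvector the quadratic form inequality reads `σ² ≤ M σ`. -/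
theorem eigenvalue_mem (hA : IsPosBounded A M) (hM : 0 ≤ M) {σ : ℝ} {x : H} (hx : A x = σ • x)
    (h0 : x ≠ 0) : 0 ≤ σ ∧ σ ≤ M := by
  have h1 := hA.sq_le x
  rw [hx, norm_smul, inner_smul_left, real_inner_self_eq_norm_sq, mul_pow, Real.norm_eq_abs,
    sq_abs] at h1
  have h2 : 0 < ‖x‖ ^ 2 := by positivity
  have h3 : σ ^ 2 ≤ M * σ := by
    refine le_of_mul_le_mul_right ?_ h2
    simpa [mul_assoc] using h1
  constructor
  · by_contra! h
    nlinarith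
  · by_contra! h
    nlinarith

/-- Expanding the square, `M⁻² ‖A x‖²` is absorbed by half of the cross term. Contractivity of `1 -
A / M` is what keeps its high powers Lipschitz in `A`. -/
theorem norm_sub_le (hA : IsPosBounded A M) (hM : 0 < M) :
    ‖(1 : H →L[ℝ] H) - M⁻¹ • A‖ ≤ 1 := by
  refine ContinuousLinearMap.opNorm_le_bound _ zero_le_one fun x => ?_
  rw [one_mul]
  refine le_of_sq_le_sq ?_ (norm_nonneg _)
  have h1 : ((1 : H →L[ℝ] H) - M⁻¹ • A) x = x - M⁻¹ • A x := by simp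
  rw [h1, norm_sub_sq_real, norm_smul, inner_smul_right, mul_pow, Real.norm_eq_abs, sq_abs]
  have h2 := hA.sq_le x
  have h3 : (M⁻¹) ^ 2 * ‖A x‖ ^ 2 ≤ M⁻¹ * inner ℝ x (A x) := by
    calc (M⁻¹) ^ 2 * ‖A x‖ ^ 2 ≤ (M⁻¹) ^ 2 * (M * inner ℝ (A x) x) := by gcongr
      _ = M⁻¹ * inner ℝ x (A x) := by
        rw [real_inner_comm]; field_simp
  have h4 : 0 ≤ M⁻¹ * inner ℝ x (A x) := le_trans (by positivity) h3
  linarith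

variable [CompleteSpace H]

/-- The orthogonal projection on the eigenspace of `A` for `σ`. -/
noncomputable def _root_.eigenProjection (A : H →L[ℝ] H) (σ : ℝ) : H →L[ℝ] H :=
  (A - σ • ContinuousLinearMap.id ℝ H).ker.starProjection

omit [CompleteSpace H] in
theorem _root_.mem_ker_sub_smul {σ : ℝ} {x : H} :
    x ∈ (A - σ • ContinuousLinearMap.id ℝ H).ker ↔ A x = σ • x := by
  simp [LinearMap.mem_ker, sub_eq_zero]

theorem _root_.eigenProjection_mem (A : H →L[ℝ] H) (σ : ℝ) (x : H) :
    eigenProjection A σ x ∈ (A - σ • ContinuousLinearMap.id ℝ H).ker :=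
  Submodule.starProjection_apply_mem _ x

theorem _root_.inner_eigenProjection_left (A : H →L[ℝ] H) (σ : ℝ) (x y : H) :
    inner ℝ (eigenProjection A σ x) y = inner ℝ x (eigenProjection A σ y) :=
  Submodule.inner_starProjection_left_eq_right _ _ _

theorem _root_.spectralApply_eq (A : H →L[ℝ] H) (φ : ℝ → ℝ) (x : H) :
    spectralApply A φ x = ∑' σ : ℝ, φ σ • eigenProjection A σ x :=
  rfl

theorem _root_.apply_eigenProjection (A : H →L[ℝ] H) (σ : ℝ) (x : H) :
    A (eigenProjection A σ x) = σ • eigenProjection A σ x :=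
  mem_ker_sub_smul.1 (eigenProjection_mem A σ x)

omit [CompleteSpace H] in
theorem inner_eq_zero (hA : IsPosBounded A M) {σ τ : ℝ} (h : σ ≠ τ) {x y : H}
    (hx : A x = σ • x) (hy : A y = τ • y) : inner ℝ x y = 0 := by
  have h1 := hA.symm x y
  rw [hx, hy, inner_smul_left, inner_smul_right] at h1
  have h2 : (σ - τ) * inner ℝ x y = 0 := by
    have h3 : σ * inner ℝ x y = τ * inner ℝ x y := h1
    linarith
  exact (mul_eq_zero.1 h2).resolve_left (sub_ne_zero.2 h)

theorem eigenProjection_comp (hA : IsPosBounded A M) {σ τ : ℝ} (h : σ ≠ τ) (x : H) :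
    eigenProjection A τ (eigenProjection A σ x) = 0 := by
  rw [eigenProjection, Submodule.starProjection_apply_eq_zero_iff]
  intro y hy
  exact hA.inner_eq_zero h.symm (mem_ker_sub_smul.1 hy) (apply_eigenProjection A σ x)

theorem eigenProjection_self (A : H →L[ℝ] H) (σ : ℝ) (x : H) :
    eigenProjection A σ (eigenProjection A σ x) = eigenProjection A σ x :=
  Submodule.starProjection_eq_self_iff.2 (Submodule.starProjection_apply_mem _ x)

theorem eigenProjection_eq_zero (hA : IsPosBounded A M) (hM : 0 ≤ M) {σ : ℝ}
    (hσ : ¬ (0 ≤ σ ∧ σ ≤ M)) (x : H) : eigenProjection A σ x = 0 := by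
  by_contra h
  exact hσ (hA.eigenvalue_mem hM (apply_eigenProjection A σ x) h)

omit [CompleteSpace H] in
theorem orthogonalFamily (hA : IsPosBounded A M) :
    OrthogonalFamily ℝ (fun σ : ℝ => (A - σ • ContinuousLinearMap.id ℝ H).ker)
      fun σ => (A - σ • ContinuousLinearMap.id ℝ H).ker.subtypeₗᵢ :=
  fun _ _ h v w => hA.inner_eq_zero h (mem_ker_sub_smul.1 v.2) (mem_ker_sub_smul.1 w.2)

theorem norm_sum_sq (hA : IsPosBounded A M) (φ : ℝ → ℝ) (x : H) (s : Finset ℝ) :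
    ‖∑ σ ∈ s, φ σ • eigenProjection A σ x‖ ^ 2 =
      ∑ σ ∈ s, φ σ ^ 2 * ‖eigenProjection A σ x‖ ^ 2 := by
  rw [← real_inner_self_eq_norm_sq]
  simp only [sum_inner, inner_sum]
  refine Finset.sum_congr rfl fun σ hσ => ?_
  rw [Finset.sum_eq_single σ]
  · rw [real_inner_smul_left, real_inner_smul_right, real_inner_self_eq_norm_sq]
    ring
  · intro τ _ hτ
    rw [real_inner_smul_left, real_inner_smul_right, hA.inner_eq_zero hτ
      (apply_eigenProjection A τ x) (apply_eigenProjection A σ x), mul_zero, mul_zero]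
  · exact fun h => absurd hσ h

theorem inner_sum_apply (hA : IsPosBounded A M) (φ : ℝ → ℝ) (x : H) (s : Finset ℝ) :
    inner ℝ (A (∑ σ ∈ s, φ σ • eigenProjection A σ x)) (∑ σ ∈ s, φ σ • eigenProjection A σ x) =
      ∑ σ ∈ s, σ * φ σ ^ 2 * ‖eigenProjection A σ x‖ ^ 2 := by
  simp only [map_sum, map_smul, apply_eigenProjection, smul_smul, sum_inner, inner_sum]
  refine Finset.sum_congr rfl fun σ hσ => ?_
  rw [Finset.sum_eq_single σ]
  · rw [real_inner_smul_left, real_inner_smul_right, real_inner_self_eq_norm_sq]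
    ring
  · intro τ _ hτ
    rw [real_inner_smul_left, real_inner_smul_right, hA.inner_eq_zero hτ
      (apply_eigenProjection A τ x) (apply_eigenProjection A σ x), mul_zero, mul_zero]
  · exact fun h => absurd hσ h

/-- Bessel's inequality: the sum is both `‖y‖²` and `⟨y, x⟩` for `y` the partial sum of the
projections, so Cauchy–Schwarz gives `‖y‖ ≤ ‖x‖`. -/
theorem sum_norm_sq_le (hA : IsPosBounded A M) (x : H) (s : Finset ℝ) :
    ∑ σ ∈ s, ‖eigenProjection A σ x‖ ^ 2 ≤ ‖x‖ ^ 2 := by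
  have h1 := hA.norm_sum_sq (fun _ => 1) x s
  simp only [one_smul, one_pow, one_mul] at h1
  have h2 : inner ℝ (∑ σ ∈ s, eigenProjection A σ x) x =
      ∑ σ ∈ s, ‖eigenProjection A σ x‖ ^ 2 := by
    rw [sum_inner]
    refine Finset.sum_congr rfl fun σ _ => ?_
    rw [← real_inner_self_eq_norm_sq]
    nth_rewrite 1 [← eigenProjection_self A σ x]
    exact inner_eigenProjection_left A σ _ _
  have h3 := real_inner_le_norm (∑ σ ∈ s, eigenProjection A σ x) x
  rw [h2, ← h1] at h3
  rw [← h1]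
  set t := ‖∑ σ ∈ s, eigenProjection A σ x‖
  have h4 : 0 ≤ t := norm_nonneg _
  have h5 : 0 ≤ ‖x‖ := norm_nonneg _
  rcases h4.eq_or_lt with h6 | h6
  · rw [← h6, zero_pow two_ne_zero]; positivity
  · have : t ≤ ‖x‖ := by nlinarith
    gcongr

theorem sum_weight_le (hA : IsPosBounded A M) (hM : 0 ≤ M) {φ : ℝ → ℝ} {a : ℝ} (ha : 0 ≤ a)
    (hφ : ∀ σ, 0 ≤ σ → σ ≤ M → φ σ ≤ a) (x : H) (s : Finset ℝ) :
    ∑ σ ∈ s, φ σ * ‖eigenProjection A σ x‖ ^ 2 ≤ a * ‖x‖ ^ 2 := by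
  calc _ ≤ ∑ σ ∈ s, a * ‖eigenProjection A σ x‖ ^ 2 := by
        refine Finset.sum_le_sum fun σ _ => ?_
        by_cases h : 0 ≤ σ ∧ σ ≤ M
        · have := hφ σ h.1 h.2
          gcongr
        · simp [hA.eigenProjection_eq_zero hM h]
    _ ≤ _ := by
      rw [← Finset.mul_sum]
      have := hA.sum_norm_sq_le x s
      gcongr

/-- Bounded functions give a summable spectral series. -/
theorem hasSum_spectralApply (hA : IsPosBounded A M) (hM : 0 ≤ M) {φ : ℝ → ℝ} {a : ℝ}
    (hφ : ∀ σ, 0 ≤ σ → σ ≤ M → |φ σ| ≤ a) (x : H) :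
    HasSum (fun σ => φ σ • eigenProjection A σ x) (spectralApply A φ x) := by
  refine Summable.hasSum ?_
  have h := (hA.orthogonalFamily.summable_iff_norm_sq_summable (fun σ => φ σ •
    ⟨eigenProjection A σ x, eigenProjection_mem A σ x⟩)).2 ?_
  · exact h
  · refine summable_of_sum_le (c := a ^ 2 * ‖x‖ ^ 2) (fun _ => sq_nonneg _) fun s => ?_
    refine le_trans (le_of_eq (Finset.sum_congr rfl fun σ _ => ?_))
      (hA.sum_weight_le hM (φ := fun σ => φ σ ^ 2) (sq_nonneg a)
        (fun σ h0 h1 => sq_le_sq' (neg_le_of_abs_le (hφ σ h0 h1)) (le_of_abs_le (hφ σ h0 h1))) x s)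
    rw [norm_smul, mul_pow, Real.norm_eq_abs, sq_abs]
    rfl

theorem norm_spectralApply_le (hA : IsPosBounded A M) (hM : 0 ≤ M) {φ : ℝ → ℝ} {a : ℝ}
    (hφ : ∀ σ, 0 ≤ σ → σ ≤ M → |φ σ| ≤ a) (x : H) : ‖spectralApply A φ x‖ ≤ a * ‖x‖ := by
  have ha : 0 ≤ a := (abs_nonneg _).trans (hφ 0 le_rfl hM)
  refine le_of_tendsto (hA.hasSum_spectralApply hM hφ x).norm (Filter.Eventually.of_forall
    fun s => ?_)
  refine le_of_sq_le_sq ?_ (by positivity)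
  rw [hA.norm_sum_sq, mul_pow]
  exact hA.sum_weight_le hM (φ := fun σ => φ σ ^ 2) (sq_nonneg a)
    (fun σ h0 h1 => sq_le_sq' (neg_le_of_abs_le (hφ σ h0 h1)) (le_of_abs_le (hφ σ h0 h1))) x s

theorem inner_spectralApply_le (hA : IsPosBounded A M) (hM : 0 ≤ M) {φ : ℝ → ℝ} {a c : ℝ}
    (hφ : ∀ σ, 0 ≤ σ → σ ≤ M → |φ σ| ≤ a) (hc : 0 ≤ c)
    (hφ' : ∀ σ, 0 ≤ σ → σ ≤ M → σ * φ σ ^ 2 ≤ c) (x : H) :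
    inner ℝ (A (spectralApply A φ x)) (spectralApply A φ x) ≤ c * ‖x‖ ^ 2 := by
  have h := hA.hasSum_spectralApply hM hφ x
  have h2 := ((A.continuous.tendsto _).comp h).inner h (𝕜 := ℝ)
  refine le_of_tendsto h2 (Filter.Eventually.of_forall fun s => ?_)
  exact (hA.inner_sum_apply φ x s).le.trans
    (hA.sum_weight_le hM (φ := fun σ => σ * φ σ ^ 2) hc hφ' x s)

theorem eigenProjection_spectralApply (hA : IsPosBounded A M) (hM : 0 ≤ M) {φ : ℝ → ℝ} {a : ℝ}
    (hφ : ∀ σ, 0 ≤ σ → σ ≤ M → |φ σ| ≤ a) (x : H) (τ : ℝ) :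
    eigenProjection A τ (spectralApply A φ x) = φ τ • eigenProjection A τ x := by
  have h := (eigenProjection A τ).hasSum (hA.hasSum_spectralApply hM hφ x)
  refine h.unique ?_
  have h2 := hasSum_single (f := fun σ => eigenProjection A τ (φ σ • eigenProjection A σ x)) τ
    (fun σ hσ => by rw [map_smul, hA.eigenProjection_comp hσ, smul_zero])
  rwa [map_smul, eigenProjection_self] at h2

theorem spectralApply_spectralApply (hA : IsPosBounded A M) (hM : 0 ≤ M) {φ : ℝ → ℝ} {a : ℝ}
    (hφ : ∀ σ, 0 ≤ σ → σ ≤ M → |φ σ| ≤ a) (ψ : ℝ → ℝ) (x : H) :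
    spectralApply A ψ (spectralApply A φ x) = spectralApply A (fun σ => ψ σ * φ σ) x := by
  rw [spectralApply_eq A ψ, spectralApply_eq A (fun σ => ψ σ * φ σ)]
  refine tsum_congr fun σ => ?_
  have := hA.eigenProjection_spectralApply hM hφ x σ
  rw [mul_smul, ← this]

theorem spectralApply_congr (hA : IsPosBounded A M) (hM : 0 ≤ M) {φ ψ : ℝ → ℝ}
    (h : ∀ σ, 0 ≤ σ → σ ≤ M → φ σ = ψ σ) (x : H) : spectralApply A φ x = spectralApply A ψ x := by
  rw [spectralApply_eq, spectralApply_eq]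
  refine tsum_congr fun σ => ?_
  by_cases hσ : 0 ≤ σ ∧ σ ≤ M
  · rw [h σ hσ.1 hσ.2]
  · have := hA.eigenProjection_eq_zero hM hσ x
    rw [this, smul_zero, smul_zero]

theorem spectralApply_sub (hA : IsPosBounded A M) (hM : 0 ≤ M) {φ : ℝ → ℝ} {a : ℝ}
    (hφ : ∀ σ, 0 ≤ σ → σ ≤ M → |φ σ| ≤ a) (x y : H) :
    spectralApply A φ (x - y) = spectralApply A φ x - spectralApply A φ y := by
  refine (hA.hasSum_spectralApply hM hφ _).unique ?_
  simpa [smul_sub] using (hA.hasSum_spectralApply hM hφ x).sub (hA.hasSum_spectralApply hM hφ y)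

theorem spectralApply_sub_fun (hA : IsPosBounded A M) (hM : 0 ≤ M) {φ ψ : ℝ → ℝ} {a b : ℝ}
    (hφ : ∀ σ, 0 ≤ σ → σ ≤ M → |φ σ| ≤ a) (hψ : ∀ σ, 0 ≤ σ → σ ≤ M → |ψ σ| ≤ b) (x : H) :
    spectralApply A (fun σ => φ σ - ψ σ) x = spectralApply A φ x - spectralApply A ψ x := by
  rw [spectralApply_eq A (fun σ => φ σ - ψ σ)]
  refine HasSum.tsum_eq ?_
  simpa only [sub_smul] using
    (hA.hasSum_spectralApply hM hφ x).sub (hA.hasSum_spectralApply hM hψ x)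

theorem aeval_apply_eigenProjection (A : H →L[ℝ] H) (p : Polynomial ℝ) (σ : ℝ) (x : H) :
    Polynomial.aeval A p (eigenProjection A σ x) = p.eval σ • eigenProjection A σ x := by
  induction p using Polynomial.induction_on' with
  | add p q hp hq => simp only [map_add, add_apply, hp, hq, Polynomial.eval_add,
      add_smul]
  | monomial n a =>
    have h : ∀ n : ℕ, (A ^ n) (eigenProjection A σ x) = σ ^ n • eigenProjection A σ x := by
      intro n
      induction n with
      | zero => simp
      | succ n ih => rw [pow_succ', mul_apply_eq_comp, ih, map_smul,
          apply_eigenProjection, smul_smul, pow_succ]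
    simp only [Polynomial.aeval_monomial, Polynomial.eval_monomial, mul_apply_eq_comp,
      h, Algebra.algebraMap_eq_smul_one, smul_apply,
      one_apply_eq_self, smul_smul]

theorem aeval_spectralApply (hA : IsPosBounded A M) (hM : 0 ≤ M) {φ : ℝ → ℝ} {a : ℝ}
    (hφ : ∀ σ, 0 ≤ σ → σ ≤ M → |φ σ| ≤ a) (p : Polynomial ℝ) (x : H) :
    Polynomial.aeval A p (spectralApply A φ x) = spectralApply A (fun σ => p.eval σ * φ σ) x := by
  have h := (Polynomial.aeval A p).hasSum (hA.hasSum_spectralApply hM hφ x)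
  rw [spectralApply_eq A (fun σ => p.eval σ * φ σ)]
  refine (HasSum.tsum_eq ?_).symm
  convert h using 2 with σ
  rw [map_smul, aeval_apply_eigenProjection, smul_smul, mul_comm]

/-- This is where compactness enters: the eigenspaces have trivial orthogonal complement, and the
remainder of the series is orthogonal to all of them. -/
theorem spectralApply_one (hA : IsPosBounded A M) (hM : 0 ≤ M) (hc : IsCompactOperator A)
    (x : H) : spectralApply A (fun _ => 1) x = x := by
  have hb : ∀ σ, 0 ≤ σ → σ ≤ M → |(fun _ : ℝ => (1 : ℝ)) σ| ≤ 1 := by simp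
  have hs : A.toLinearMap.IsSymmetric := fun x y => hA.symm x y
  have h := ContinuousLinearMap.orthogonalComplement_iSup_eigenspaces_eq_bot hc hs
  rw [← sub_eq_zero, ← Submodule.mem_bot ℝ, ← h, Submodule.mem_orthogonal]
  intro u hu
  have key : ∀ σ : ℝ, ∀ y : H, A y = σ • y →
      inner ℝ y (spectralApply A (fun _ => 1) x - x) = 0 := by
    intro σ y hy
    have h1 : eigenProjection A σ (spectralApply A (fun _ => 1) x - x) = 0 := by
      rw [map_sub, hA.eigenProjection_spectralApply hM hb, one_smul, sub_self]
    have h2 : eigenProjection A σ y = y :=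
      Submodule.starProjection_eq_self_iff.2 (mem_ker_sub_smul.2 hy)
    rw [← h2]
    rw [inner_eigenProjection_left, h1, inner_zero_right]
  refine Submodule.iSup_induction _ (motive := fun u : H =>
    inner ℝ u (spectralApply A (fun _ => 1) x - x) = 0) hu (fun σ y hy => ?_) (by simp) ?_
  · exact key σ y (Module.End.mem_eigenspace_iff.1 hy)
  · intro a b ha hb
    rw [inner_add_left, ha, hb, add_zero]

end IsPosBounded

/-! ### Polynomial substitutes for fractional powers. -/

/-- Telescoping, without commutativity. It is needed with `c = 1` for powers of contractions and
with `c = 2` for powers of `1 - a ^ (2 ^ j)`. -/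
theorem norm_pow_sub_pow_le {R : Type*} [NormedRing R] [NormOneClass R] {a b : R} {c : ℝ}
    (hc : 1 ≤ c) (ha : ‖a‖ ≤ c) (hb : ‖b‖ ≤ c) (n : ℕ) :
    ‖a ^ n - b ^ n‖ ≤ n * c ^ n * ‖a - b‖ := by
  induction n with
  | zero => simp
  | succ n ih =>
    have h1 : a ^ (n + 1) - b ^ (n + 1) = (a ^ n - b ^ n) * a + b ^ n * (a - b) := by
      noncomm_ring
    have h2 : ‖b ^ n‖ ≤ c ^ n := (norm_pow_le b n).trans (by gcongr)
    have h3 : c ^ n ≤ c ^ (n + 1) := pow_le_pow_right₀ hc (Nat.le_succ n)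
    calc ‖a ^ (n + 1) - b ^ (n + 1)‖ ≤ ‖a ^ n - b ^ n‖ * ‖a‖ + ‖b ^ n‖ * ‖a - b‖ := by
          rw [h1]
          exact (norm_add_le _ _).trans (add_le_add (norm_mul_le _ _) (norm_mul_le _ _))
      _ ≤ (n * c ^ n * ‖a - b‖) * c + c ^ (n + 1) * ‖a - b‖ := by gcongr; exact h2.trans h3
      _ = _ := by push_cast; ring

/-- A polynomial which at `1 - x` is comparable with `x ^ r + w ^ J`, where `w = 2 ^ (-r)`. -/
noncomputable def powerApprox (w : ℝ) (p J : ℕ) : Polynomial ℝ :=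
  Polynomial.C (w ^ J) + ∑ j ∈ Finset.range (J + 1), Polynomial.C (w ^ j) *
    (1 - Polynomial.X ^ (2 ^ j)) ^ p

theorem eval_powerApprox (w : ℝ) (p J : ℕ) (y : ℝ) :
    (powerApprox w p J).eval y =
      w ^ J + ∑ j ∈ Finset.range (J + 1), w ^ j * (1 - y ^ (2 ^ j)) ^ p := by
  simp [powerApprox, Polynomial.eval_finsetSum]

/-- The summand at scale `j` is Lipschitz with constant of order `2 ^ j`, since `a` and `b` are
contractions, and the geometric sum is dominated by the last scale. -/
theorem norm_aeval_powerApprox_sub_le {R : Type*} [NormedRing R] [NormOneClass R]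
    [NormedAlgebra ℝ R] {w : ℝ} (hw0 : 0 ≤ w) (hw1 : w ≤ 1) (p J : ℕ) {a b : R} (ha : ‖a‖ ≤ 1)
    (hb : ‖b‖ ≤ 1) :
    ‖Polynomial.aeval a (powerApprox w p J) - Polynomial.aeval b (powerApprox w p J)‖ ≤
      2 * (p * 2 ^ p) * 2 ^ J * ‖a - b‖ := by
  have hpow : ∀ {c : R}, ‖c‖ ≤ 1 → ∀ n : ℕ, ‖1 - c ^ n‖ ≤ 2 := fun {c} hc n =>
    calc ‖1 - c ^ n‖ ≤ ‖(1 : R)‖ + ‖c ^ n‖ := norm_sub_le _ _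
      _ ≤ 1 + 1 := by
        rw [norm_one]
        gcongr
        exact (norm_pow_le c n).trans (pow_le_one₀ (norm_nonneg _) hc)
      _ = 2 := by norm_num
  have key : ∀ j : ℕ, ‖(w ^ j) • ((1 - a ^ (2 ^ j)) ^ p - (1 - b ^ (2 ^ j)) ^ p)‖ ≤
      2 ^ j * (p * 2 ^ p * ‖a - b‖) := by
    intro j
    have h1 := norm_pow_sub_pow_le one_le_two (hpow ha (2 ^ j)) (hpow hb (2 ^ j)) p
    have h2 := norm_pow_sub_pow_le le_rfl ha hb (2 ^ j)
    rw [sub_sub_sub_cancel_left, norm_sub_rev (b ^ _)] at h1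
    rw [norm_smul, Real.norm_eq_abs, abs_of_nonneg (by positivity)]
    calc _ ≤ 1 * (p * 2 ^ p * (((2 ^ j : ℕ) : ℝ) * 1 ^ (2 ^ j) * ‖a - b‖)) := by
          gcongr
          · exact pow_le_one₀ hw0 hw1
          · exact h1.trans (by gcongr)
      _ = _ := by push_cast; ring
  have h3 : Polynomial.aeval a (powerApprox w p J) - Polynomial.aeval b (powerApprox w p J) =
      ∑ j ∈ Finset.range (J + 1),
        (w ^ j) • ((1 - a ^ (2 ^ j)) ^ p - (1 - b ^ (2 ^ j)) ^ p) := by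
    simp only [powerApprox, map_add, map_sum, map_mul, map_pow, map_sub, map_one,
      Polynomial.aeval_X, Polynomial.aeval_C, add_sub_add_left_eq_sub, ← Finset.sum_sub_distrib]
    refine Finset.sum_congr rfl fun j _ => ?_
    rw [← mul_sub, ← map_pow, Algebra.smul_def]
  rw [h3]
  calc _ ≤ ∑ j ∈ Finset.range (J + 1), 2 ^ j * (p * 2 ^ p * ‖a - b‖) :=
        norm_sum_le_of_le _ fun j _ => key j
    _ = (2 ^ (J + 1) - 1) * (p * 2 ^ p * ‖a - b‖) := by
        rw [← Finset.sum_mul, geom_sum_eq (by norm_num)]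
        norm_num
    _ ≤ (2 ^ (J + 1)) * (p * 2 ^ p * ‖a - b‖) := by gcongr; linarith
    _ = _ := by ring

theorem exists_two_pow_mul_mem {x : ℝ} (hx : x ≤ 1) (J : ℕ) (h : 1 ≤ 2 ^ J * x) :
    ∃ j ≤ J, 1 ≤ 2 ^ j * x ∧ 2 ^ j * x ≤ 2 := by
  induction J with
  | zero => exact ⟨0, le_rfl, h, by simp; linarith⟩
  | succ J ih =>
    by_cases h2 : 2 ^ (J + 1) * x ≤ 2
    · exact ⟨J + 1, le_rfl, h, h2⟩
    · obtain ⟨j, hj, h3⟩ := ih (by rw [pow_succ] at h2; linarith)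
      exact ⟨j, hj.trans (Nat.le_succ J), h3⟩

theorem two_rpow_neg_pow (r : ℝ) (j : ℕ) : ((2 : ℝ) ^ (-r)) ^ j = ((2 : ℝ) ^ j)⁻¹ ^ r := by
  rw [← Real.rpow_natCast, ← Real.rpow_mul (by norm_num), Real.inv_rpow (by positivity),
    ← Real.rpow_neg (by positivity), ← Real.rpow_natCast, ← Real.rpow_mul (by norm_num)]
  ring_nf

/-- A single summand suffices: if `2 ^ j * x ∈ [1, 2]`, then `(1 - x) ^ (2 ^ j) ≤ 1 / e ≤ 1 / 2`
while `x ^ r ≤ 2 ^ r w ^ j`, where `w = 2 ^ (-r)`. If `x` is below the finest scale, the constant `w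
^ J` already dominates `x ^ r`. -/
theorem rpow_le_eval_powerApprox {r : ℝ} (hr : 0 < r) (p J : ℕ) {x : ℝ} (hx0 : 0 ≤ x)
    (hx1 : x ≤ 1) :
    x ^ r ≤ 2 ^ r * 2 ^ p * (powerApprox (2 ^ (-r)) p J).eval (1 - x) := by
  rw [eval_powerApprox]
  have hw : (0 : ℝ) < 2 ^ (-r) := by positivity
  have hnn : ∀ j : ℕ, 0 ≤ 1 - (1 - x) ^ (2 ^ j) := fun j => by
    have : (1 - x) ^ (2 ^ j) ≤ 1 := pow_le_one₀ (by linarith) (by linarith)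
    linarith
  have hs : ∀ j ∈ Finset.range (J + 1), 0 ≤ ((2 : ℝ) ^ (-r)) ^ j * (1 - (1 - x) ^ (2 ^ j)) ^ p :=
    fun j _ => mul_nonneg (by positivity) (pow_nonneg (hnn j) p)
  have h2r : (1 : ℝ) ≤ 2 ^ r := Real.one_le_rpow one_le_two hr.le
  have h2p : (1 : ℝ) ≤ 2 ^ p := one_le_pow₀ one_le_two
  by_cases h : 1 ≤ 2 ^ J * x
  · obtain ⟨j, hj, h1, h2⟩ := exists_two_pow_mul_mem hx1 J h
    have h3 : (1 - x) ^ (2 ^ j) ≤ 1 / 2 := by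
      calc (1 - x) ^ (2 ^ j) ≤ (Real.exp (-x)) ^ (2 ^ j) := by
            have := Real.one_sub_le_exp_neg x
            gcongr
        _ = Real.exp (-(2 ^ j * x)) := by
            rw [← Real.exp_nat_mul]; push_cast; ring_nf
        _ ≤ Real.exp (-1) := Real.exp_le_exp.2 (by linarith)
        _ ≤ 1 / 2 := by
            rw [Real.exp_neg, one_div]
            have := Real.add_one_le_exp (1 : ℝ)
            exact inv_anti₀ (by norm_num) (by linarith)
    have h4 := Finset.single_le_sum hs (Finset.mem_range.2 (Nat.lt_succ_of_le hj))
    have h5 : x ≤ 2 * (2 ^ j)⁻¹ := by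
      rw [← div_eq_mul_inv, le_div_iff₀ (by positivity)]
      linarith
    calc x ^ r ≤ (2 * (2 ^ j)⁻¹) ^ r := by gcongr
      _ = 2 ^ r * 2 ^ p * (((2 : ℝ) ^ (-r)) ^ j * (1 / 2) ^ p) := by
          rw [Real.mul_rpow (by norm_num) (by positivity), two_rpow_neg_pow, one_div, inv_pow]
          field_simp
      _ ≤ 2 ^ r * 2 ^ p * (((2 : ℝ) ^ (-r)) ^ j * (1 - (1 - x) ^ (2 ^ j)) ^ p) := by
          gcongr
          linarith
      _ ≤ _ := by
          gcongr
          have : 0 ≤ ((2 : ℝ) ^ (-r)) ^ J := by positivity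
          linarith
  · have h6 := Finset.sum_nonneg hs
    have h7 : x ≤ (2 ^ J)⁻¹ := by
      rw [← one_div, le_div_iff₀ (by positivity)]
      linarith
    have h8 : x ^ r ≤ ((2 : ℝ) ^ (-r)) ^ J := by
      rw [two_rpow_neg_pow]
      gcongr
    calc x ^ r ≤ 1 * ((2 : ℝ) ^ (-r)) ^ J := by linarith
      _ ≤ 2 ^ r * 2 ^ p * (((2 : ℝ) ^ (-r)) ^ J + 0) := by
        rw [add_zero]
        gcongr
        nlinarith
      _ ≤ _ := by gcongr

/-- For `x < 1 / 2` the sum is self-similar: `S_{n+1}(x) = x ^ p + w S_n(2 x)`. The induction runs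
on the stronger bound `A x ^ r - B x ^ p`: `w 2 ^ r = 1` preserves the first term, and `B (w 2 ^ p -
1) = 1` absorbs the new `x ^ p`. Positivity of `B` is where `r < p` is used. -/
theorem sum_geom_min_le {r : ℝ} (hr : 0 < r) {p : ℕ} (hp : r < p) :
    ∃ K : ℝ, 0 < K ∧ ∀ (n : ℕ) (x : ℝ), 0 ≤ x → x ≤ 1 →
      ∑ j ∈ Finset.range n, ((2 : ℝ) ^ (-r)) ^ j * min 1 (2 ^ j * x) ^ p ≤ K * x ^ r := by
  set w : ℝ := 2 ^ (-r) with hw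
  have hw0 : 0 < w := by positivity
  have hw1 : w < 1 := Real.rpow_lt_one_of_one_lt_of_neg one_lt_two (by linarith)
  have hw2 : w * 2 ^ r = 1 := by rw [hw, ← Real.rpow_add (by norm_num)]; simp
  have hwp : 1 < w * 2 ^ p := by
    rw [← hw2]
    gcongr
    rw [← Real.rpow_natCast]
    exact Real.rpow_lt_rpow_of_exponent_lt one_lt_two hp
  have hp0 : p ≠ 0 := by rintro rfl; simp at hp; linarith
  set B : ℝ := 1 / (w * 2 ^ p - 1) with hB
  have hB0 : 0 < B := by rw [hB]; exact one_div_pos.2 (by linarith)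
  have hB1 : B * (w * 2 ^ p - 1) = 1 := by
    rw [hB]; exact one_div_mul_cancel (by linarith)
  set A : ℝ := (1 / (1 - w) + B) * 2 ^ r with hA
  have h1w : 0 < 1 / (1 - w) := one_div_pos.2 (by linarith)
  have h2r : (1 : ℝ) ≤ 2 ^ r := Real.one_le_rpow one_le_two hr.le
  have hAB : B ≤ A := by rw [hA]; nlinarith
  have hxp : ∀ x : ℝ, 0 ≤ x → x ≤ 1 → x ^ p ≤ x ^ r := fun x h0 h1 => by
    rcases h0.eq_or_lt with h | h
    · rw [← h, zero_pow hp0, Real.zero_rpow hr.ne']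
    · rw [← Real.rpow_natCast]
      exact Real.rpow_le_rpow_of_exponent_ge h h1 hp.le
  have key : ∀ (n : ℕ) (x : ℝ), 0 ≤ x → x ≤ 1 →
      ∑ j ∈ Finset.range n, w ^ j * min 1 (2 ^ j * x) ^ p ≤ A * x ^ r - B * x ^ p := by
    intro n
    induction n with
    | zero =>
      intro x h0 h1
      have h2 := hxp x h0 h1
      have h3 : 0 ≤ x ^ p := by positivity
      simp only [Finset.range_zero, Finset.sum_empty]
      nlinarith
    | succ n ih =>
      intro x h0 h1
      by_cases hx : 1 / 2 ≤ x
      · have h2 : ∑ j ∈ Finset.range (n + 1), w ^ j * min 1 (2 ^ j * x) ^ p ≤ 1 / (1 - w) := by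
          calc _ ≤ ∑ j ∈ Finset.range (n + 1), w ^ j := by
                refine Finset.sum_le_sum fun j _ => ?_
                refine mul_le_of_le_one_right (by positivity)
                  (pow_le_one₀ (by positivity) (min_le_left _ _))
            _ ≤ 1 / (1 - w) := by
                rw [geom_sum_eq hw1.ne, ← neg_div_neg_eq]
                have : 0 < w ^ (n + 1) := by positivity
                have h5 : 0 < 1 - w := by linarith
                rw [neg_sub, neg_sub]
                gcongr
                linarith
        have h3 : 1 ≤ 2 ^ r * x ^ r := by
          rw [← Real.mul_rpow (by norm_num) h0]
          exact Real.one_le_rpow (by linarith) hr.le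
        have h4 : x ^ p ≤ 1 := pow_le_one₀ h0 h1
        rw [hA]
        nlinarith
      · have h2 := ih (2 * x) (by linarith) (by linarith)
        rw [Finset.sum_range_succ', pow_zero, pow_zero, one_mul, one_mul, min_eq_right h1]
        have h3 : ∑ j ∈ Finset.range n, w ^ (j + 1) * min 1 (2 ^ (j + 1) * x) ^ p =
            w * ∑ j ∈ Finset.range n, w ^ j * min 1 (2 ^ j * (2 * x)) ^ p := by
          rw [Finset.mul_sum]
          refine Finset.sum_congr rfl fun j _ => ?_
          rw [pow_succ, pow_succ, mul_assoc (2 ^ j) 2 x]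
          ring
        rw [h3]
        have h4 := mul_le_mul_of_nonneg_left h2 hw0.le
        rw [Real.mul_rpow (by norm_num) h0, mul_pow] at h4
        have h5 : w * (A * (2 ^ r * x ^ r) - B * (2 ^ p * x ^ p)) =
            A * x ^ r * (w * 2 ^ r) - B * (w * 2 ^ p - 1) * x ^ p - B * x ^ p := by ring
        rw [h5, hw2, hB1] at h4
        linarith
  refine ⟨A, by linarith, fun n x h0 h1 => (key n x h0 h1).trans ?_⟩
  have : 0 ≤ B * x ^ p := by positivity
  linarith

/-- Bernoulli's inequality gives `1 - (1 - x) ^ (2 ^ j) ≤ min 1 (2 ^ j x)`, which reduces the claim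
to `sum_geom_min_le`. -/
theorem eval_powerApprox_le {r : ℝ} (hr : 0 < r) {p : ℕ} (hp : r < p) :
    ∃ K : ℝ, 1 ≤ K ∧ ∀ (J : ℕ) (x : ℝ), 0 ≤ x → x ≤ 1 →
      (powerApprox (2 ^ (-r)) p J).eval (1 - x) ≤ K * (x ^ r + ((2 : ℝ) ^ (-r)) ^ J) := by
  obtain ⟨K, hK, h⟩ := sum_geom_min_le hr hp
  refine ⟨K + 1, by linarith, fun J x h0 h1 => ?_⟩
  rw [eval_powerApprox]
  have hw : (0 : ℝ) < ((2 : ℝ) ^ (-r)) ^ J := by positivity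
  have hx : 0 ≤ x ^ r := by positivity
  have h2 : ∑ j ∈ Finset.range (J + 1), ((2 : ℝ) ^ (-r)) ^ j * (1 - (1 - x) ^ (2 ^ j)) ^ p ≤
      K * x ^ r := by
    refine le_trans (Finset.sum_le_sum fun j _ => ?_) (h (J + 1) x h0 h1)
    have h3 : (1 - x) ^ (2 ^ j) ≤ 1 := pow_le_one₀ (by linarith) (by linarith)
    have h4 : 1 + ((2 ^ j : ℕ) : ℝ) * (-x) ≤ (1 + -x) ^ (2 ^ j) :=
      one_add_mul_le_pow (by linarith) _
    have h5 : 0 ≤ (1 - x) ^ (2 ^ j) := pow_nonneg (by linarith) _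
    push_cast at h4
    rw [← sub_eq_add_neg 1 x] at h4
    gcongr
    exact le_min (by linarith) (by linarith)
  nlinarith

/-- For every scale `lam` there is a polynomial comparable with `σ ^ r + lam ^ r` on `[0, M]`, which
as a function of operators is Lipschitz with constant of order `1 / lam`. -/
theorem exists_polynomial_power (H : Type*) [NormedAddCommGroup H] [InnerProductSpace ℝ H]
    {M r : ℝ} (hM : 0 < M) (hr : 0 < r) :
    ∃ K : ℝ, 0 < K ∧ ∀ lam : ℝ, 0 < lam → lam ≤ M → ∃ F : Polynomial ℝ,
      (∀ σ, 0 ≤ σ → σ ≤ M →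
        0 < F.eval σ ∧ σ ^ r ≤ K * F.eval σ ∧ F.eval σ ≤ K * (σ ^ r + lam ^ r)) ∧
      ∀ A B : H →L[ℝ] H, IsPosBounded A M → IsPosBounded B M →
        ‖Polynomial.aeval A F - Polynomial.aeval B F‖ ≤ K / lam * ‖A - B‖ := by
  obtain ⟨p, hp⟩ := exists_nat_gt r
  obtain ⟨K₁, hK₁, hup⟩ := eval_powerApprox_le hr hp
  have hMr : 0 < M ^ r := by positivity
  set K₂ : ℝ := M ^ r * (2 ^ r * 2 ^ p) with hK₂
  set K₃ : ℝ := K₁ / M ^ r with hK₃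
  set K₄ : ℝ := 2 * (p * 2 ^ p) * 2 with hK₄
  have h2 : 0 < K₂ := by positivity
  have h3 : 0 < K₃ := by positivity
  have h4 : 0 ≤ K₄ := by positivity
  refine ⟨K₂ + K₃ + K₄, by positivity, fun lam hl0 hl1 => ?_⟩
  -- The lower bound on `2 ^ J` makes the constant term at most `(lam / M) ^ r`; the upper bound
  -- makes the Lipschitz constant of order `1 / lam`.
  obtain ⟨J, hJ1, hJ2⟩ : ∃ J : ℕ, M / lam ≤ 2 ^ J ∧ (2 : ℝ) ^ J ≤ 2 * (M / lam) := by
    obtain ⟨J, hJ⟩ := exists_nat_pow_near (show 1 ≤ M / lam by rwa [le_div_iff₀ hl0, one_mul])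
      (one_lt_two : (1 : ℝ) < 2)
    exact ⟨J + 1, hJ.2.le, by rw [pow_succ]; linarith [hJ.1]⟩
  have hw0 : (0 : ℝ) < 2 ^ (-r) := by positivity
  have hw1 : (2 : ℝ) ^ (-r) ≤ 1 := (Real.rpow_lt_one_of_one_lt_of_neg one_lt_two (by linarith)).le
  have hwJ : ((2 : ℝ) ^ (-r)) ^ J ≤ lam ^ r / M ^ r := by
    rw [two_rpow_neg_pow, ← Real.div_rpow hl0.le hM.le]
    gcongr
    rw [← inv_div]
    exact inv_anti₀ (by positivity) hJ1
  refine ⟨(powerApprox (2 ^ (-r)) p J).comp (1 - Polynomial.C M⁻¹ * Polynomial.X),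
    fun σ h0 h1 => ?_, fun A B hA hB => ?_⟩
  · have hx0 : 0 ≤ M⁻¹ * σ := by positivity
    have hx1 : M⁻¹ * σ ≤ 1 := by rw [inv_mul_le_iff₀ hM]; linarith
    have hev : ((powerApprox (2 ^ (-r)) p J).comp (1 - Polynomial.C M⁻¹ * Polynomial.X)).eval σ =
        (powerApprox (2 ^ (-r)) p J).eval (1 - M⁻¹ * σ) := by simp
    rw [hev]
    have hpos : 0 < (powerApprox (2 ^ (-r)) p J).eval (1 - M⁻¹ * σ) := by
      rw [eval_powerApprox]
      refine add_pos_of_pos_of_nonneg (by positivity) (Finset.sum_nonneg fun j _ =>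
        mul_nonneg (by positivity) (pow_nonneg ?_ p))
      have : (1 - M⁻¹ * σ) ^ (2 ^ j) ≤ 1 := pow_le_one₀ (by linarith) (by linarith)
      linarith
    have hσ : (M⁻¹ * σ) ^ r = σ ^ r / M ^ r := by
      rw [inv_mul_eq_div, Real.div_rpow h0 hM.le]
    have hlow := rpow_le_eval_powerApprox hr p J hx0 hx1
    have hupp := hup J _ hx0 hx1
    rw [hσ] at hlow hupp
    set V := (powerApprox (2 ^ (-r)) p J).eval (1 - M⁻¹ * σ)
    refine ⟨hpos, ?_, ?_⟩
    · rw [div_le_iff₀ hMr] at hlow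
      calc σ ^ r ≤ K₂ * V := by rw [hK₂]; linarith
        _ ≤ _ := by gcongr; linarith
    · calc V ≤ K₁ * (σ ^ r / M ^ r + lam ^ r / M ^ r) := hupp.trans (by gcongr)
        _ = K₃ * (σ ^ r + lam ^ r) := by rw [hK₃]; field_simp
        _ ≤ _ := by gcongr; linarith
  -- The Lipschitz estimate needs `‖1‖ = 1`, which fails for operators on the zero space.
  · rcases subsingleton_or_nontrivial H with hH | hH
    · rw [Subsingleton.elim A B]
      simp
    have hev : ∀ A : H →L[ℝ] H, Polynomial.aeval A
        ((powerApprox (2 ^ (-r)) p J).comp (1 - Polynomial.C M⁻¹ * Polynomial.X)) =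
        Polynomial.aeval (1 - M⁻¹ • A) (powerApprox (2 ^ (-r)) p J) := fun A => by
      rw [Polynomial.aeval_comp]
      congr 1
      simp [Algebra.smul_def]
    rw [hev, hev]
    have h5 := norm_aeval_powerApprox_sub_le hw0.le hw1 p J (hA.norm_sub_le hM)
      (hB.norm_sub_le hM)
    have h6 : ‖(1 - M⁻¹ • A) - (1 - M⁻¹ • B)‖ = M⁻¹ * ‖A - B‖ := by
      rw [sub_sub_sub_cancel_left, ← smul_sub, norm_smul, norm_sub_rev, Real.norm_eq_abs,
        abs_of_pos (by positivity)]
    rw [h6] at h5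
    calc _ ≤ 2 * (p * 2 ^ p) * (2 * (M / lam)) * (M⁻¹ * ‖A - B‖) := h5.trans (by gcongr)
      _ = K₄ / lam * ‖A - B‖ := by rw [hK₄]; field_simp
      _ ≤ _ := by gcongr; linarith

/-! ### Regularisers and their qualification. -/

/-- A qualification inequality passes to all smaller orders and to the endpoint `lam = κ ^ 2`. -/
theorem IsQualification.exists_bound {κ : ℝ} {g : ℝ → ℝ → ℝ} {rbar : EReal}
    (hg : IsRegulariser κ g) (hr : IsQualification κ g rbar) {ν : ℝ} (hν : 0 < ν)
    (h : (ν : EReal) ≤ rbar) :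
    ∃ c : ℝ, 0 < c ∧ ∀ lam : ℝ, 0 < lam → lam ≤ κ ^ 2 → ∀ σ : ℝ, 0 ≤ σ → σ ≤ κ ^ 2 →
      |1 - σ * g lam σ| * σ ^ ν ≤ c * lam ^ ν := by
  obtain ⟨B, D, γ, hB, hD, hγ, hreg⟩ := hg
  obtain ⟨ν', hνν', hq⟩ : ∃ ν', ν ≤ ν' ∧ QualifiesAt κ g ν' := by
    rcases hr with ⟨ν', rfl, h'⟩ | ⟨-, h'⟩
    · exact ⟨ν', EReal.coe_le_coe_iff.1 h, h'.1.2⟩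
    · exact ⟨ν, le_rfl, h' ν hν⟩
  obtain ⟨c, hc, hq⟩ := hq
  have hν' : 0 < ν' := hν.trans_le hνν'
  -- Interpolation weight between the bound `γ` (order `0`) and the inequality of order `ν'`.
  set θ : ℝ := ν / ν' with hθ
  have hθ0 : 0 < θ := by positivity
  have hθ1 : θ ≤ 1 := (div_le_one hν').2 hνν'
  have hθν : ν' * θ = ν := by rw [hθ]; field_simp
  refine ⟨γ ^ (1 - θ) * c ^ θ + γ, by positivity, fun lam h0 h1 σ hσ0 hσ1 => ?_⟩
  have hlam : 0 < lam ^ ν := by positivity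
  rcases hσ0.eq_or_lt with hσ | hσ
  · rw [← hσ, Real.zero_rpow hν.ne', mul_zero]
    positivity
  have hq1 := (hreg lam h0 h1).2.2 σ hσ hσ1
  -- At `lam = κ ^ 2` no qualification inequality is assumed, but there `σ ≤ lam` and the bound by
  -- `γ` is enough.
  rcases h1.eq_or_lt with hl | hl
  · calc |1 - σ * g lam σ| * σ ^ ν ≤ γ * lam ^ ν := by
          gcongr
          exact hσ1.trans hl.ge
      _ ≤ _ := by
          gcongr
          have : 0 ≤ γ ^ (1 - θ) * c ^ θ := by positivity
          linarith
  · have hq2 := hq lam h0 hl σ hσ hσ1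
    set a := |1 - σ * g lam σ|
    have ha : 0 ≤ a := abs_nonneg _
    calc a * σ ^ ν = a ^ (1 - θ) * (a * σ ^ ν') ^ θ := by
          rw [Real.mul_rpow ha (by positivity), ← Real.rpow_mul hσ0, hθν, ← mul_assoc,
            ← Real.rpow_add' ha (by norm_num), sub_add_cancel, Real.rpow_one]
      _ ≤ γ ^ (1 - θ) * (c * lam ^ ν') ^ θ := by
          gcongr
      _ = γ ^ (1 - θ) * c ^ θ * lam ^ ν := by
          rw [Real.mul_rpow hc.le (by positivity), ← Real.rpow_mul h0.le, hθν, mul_assoc]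
      _ ≤ _ := by
          gcongr
          linarith

/-- The bounds of a regulariser on the residual, including `σ = 0`. -/
theorem IsRegulariser.exists_bounds {κ : ℝ} {g : ℝ → ℝ → ℝ} (hg : IsRegulariser κ g) :
    ∃ B D γ : ℝ, 0 < B ∧ 0 < D ∧ 0 < γ ∧ ∀ lam : ℝ, 0 < lam → lam ≤ κ ^ 2 →
      ∀ σ : ℝ, 0 ≤ σ → σ ≤ κ ^ 2 →
        |g lam σ| ≤ B / lam ∧ |σ * g lam σ| ≤ D ∧ |1 - σ * g lam σ| ≤ γ := by
  obtain ⟨B, D, γ, hB, hD, hγ, h⟩ := hg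
  -- At `σ = 0` the residual equals `1`, hence `γ + 1`.
  refine ⟨B, D, γ + 1, hB, hD, by positivity, fun lam h0 h1 σ hσ0 hσ1 => ?_⟩
  obtain ⟨h2, h3, h4⟩ := h lam h0 h1
  refine ⟨h3 σ hσ0 hσ1, ?_⟩
  rcases hσ0.eq_or_lt with hσ | hσ
  · rw [← hσ]
    simp only [zero_mul, abs_zero, sub_zero, abs_one]
    exact ⟨hD.le, by linarith⟩
  · exact ⟨h2 σ hσ hσ1, (h4 σ hσ hσ1).trans (by linarith)⟩

theorem abs_mul_le_of_abs_mul_rpow_le {q F σ lam r K c γ : ℝ} (hK : 0 ≤ K) (hlam : 0 ≤ lam)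
    (hF : |F| ≤ K * (σ ^ r + lam ^ r)) (h1 : |q| * σ ^ r ≤ c * lam ^ r) (h2 : |q| ≤ γ) :
    |q * F| ≤ K * (c + γ) * lam ^ r := by
  rw [abs_mul]
  calc _ ≤ |q| * (K * (σ ^ r + lam ^ r)) := by gcongr
    _ = K * (|q| * σ ^ r + |q| * lam ^ r) := by ring
    _ ≤ K * (c * lam ^ r + γ * lam ^ r) :=
      mul_le_mul_of_nonneg_left (add_le_add h1 (by gcongr)) hK
    _ = _ := by ring

/-! ### Error decomposition and comparison of norms. -/

namespace IsPosBounded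

variable {H : Type*} [NormedAddCommGroup H] [InnerProductSpace ℝ H] [CompleteSpace H]
  {A L : H →L[ℝ] H} {M : ℝ}

theorem apply_eq_spectralApply (hA : IsPosBounded A M) (hM : 0 ≤ M) (hc : IsCompactOperator A)
    (x : H) : A x = spectralApply A (fun σ => σ) x := by
  have h := hA.aeval_spectralApply hM (φ := fun _ => 1) (a := 1) (by simp) Polynomial.X x
  rw [hA.spectralApply_one hM hc] at h
  simpa using h

theorem aeval_apply_eq_spectralApply (hA : IsPosBounded A M) (hM : 0 ≤ M)
    (hc : IsCompactOperator A) (p : Polynomial ℝ) (x : H) :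
    Polynomial.aeval A p x = spectralApply A (fun σ => p.eval σ) x := by
  have h := hA.aeval_spectralApply hM (φ := fun _ => 1) (a := 1) (by simp) p x
  rw [hA.spectralApply_one hM hc] at h
  simpa using h

/-- Decomposition of the error of a regularised solution into a data error, a residual on the
range of `p(A)` and a residual of the approximation `f ≈ p(A) u`. -/
theorem spectralApply_sub_eq (hA : IsPosBounded A M) (hM : 0 ≤ M) (hc : IsCompactOperator A)
    {φ : ℝ → ℝ} {a d e : ℝ} (hφ : ∀ σ, 0 ≤ σ → σ ≤ M → |φ σ| ≤ a)
    (hφ' : ∀ σ, 0 ≤ σ → σ ≤ M → |σ * φ σ| ≤ d) {p : Polynomial ℝ}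
    (hp : ∀ σ, 0 ≤ σ → σ ≤ M → |p.eval σ| ≤ e) (b f u : H) :
    spectralApply A φ b - f = spectralApply A φ (b - A f)
      - spectralApply A (fun σ => (1 - σ * φ σ) * p.eval σ) u
      + spectralApply A (fun σ => 1 - σ * φ σ) (Polynomial.aeval A p u - f) := by
  have h1 : ∀ σ, 0 ≤ σ → σ ≤ M → |(fun _ : ℝ => (1 : ℝ)) σ| ≤ 1 := by simp
  have hid : ∀ σ, 0 ≤ σ → σ ≤ M → |(fun σ : ℝ => σ) σ| ≤ M := fun σ h0 h1 => by
    rw [abs_of_nonneg h0]; exact h1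
  have hq : ∀ σ, 0 ≤ σ → σ ≤ M → |1 - σ * φ σ| ≤ 1 + d := fun σ h0 h1 => by
    refine (abs_sub _ _).trans ?_
    rw [abs_one]
    linarith [hφ' σ h0 h1]
  rw [hA.spectralApply_sub hM hφ, hA.spectralApply_sub hM hq,
    hA.aeval_apply_eq_spectralApply hM hc, hA.spectralApply_spectralApply hM hp,
    hA.spectralApply_sub_fun hM h1 hφ', hA.spectralApply_one hM hc,
    hA.apply_eq_spectralApply hM hc f, hA.spectralApply_spectralApply hM hid]
  have h2 : spectralApply A (fun σ => σ * φ σ) f = spectralApply A (fun σ => φ σ * σ) f :=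
    hA.spectralApply_congr hM (fun σ _ _ => mul_comm _ _) f
  rw [h2]
  abel

/-- The norm `‖I h‖` is given by the form of `L`, whereas the calculus is that of `A`. Exchanging
the forms costs `ε ‖h‖²`; the form of `A` turns into the weight `√σ`. -/
theorem norm_apply_spectralApply_le {E : Type*} [NormedAddCommGroup E] [NormedSpace ℝ E]
    (hA : IsPosBounded A M) (hM : 0 ≤ M) {I : H →L[ℝ] E}
    (hI : ∀ h, ‖I h‖ ^ 2 = inner ℝ (L h) h) {φ : ℝ → ℝ} {a c ε : ℝ} (hc0 : 0 ≤ c)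
    (hφ : ∀ σ, 0 ≤ σ → σ ≤ M → |φ σ| ≤ a) (hφ' : ∀ σ, 0 ≤ σ → σ ≤ M → √σ * |φ σ| ≤ c)
    (hε : ‖A - L‖ ≤ ε) (x : H) :
    ‖I (spectralApply A φ x)‖ ≤ (c + √ε * a) * ‖x‖ := by
  have ha : 0 ≤ a := (abs_nonneg _).trans (hφ 0 le_rfl hM)
  have hε0 : 0 ≤ ε := (norm_nonneg _).trans hε
  set h := spectralApply A φ x
  have h1 : inner ℝ (A h) h ≤ c ^ 2 * ‖x‖ ^ 2 := by
    refine hA.inner_spectralApply_le hM hφ (sq_nonneg c) (fun σ h0 h1 => ?_) x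
    have h2 := hφ' σ h0 h1
    calc σ * φ σ ^ 2 = (√σ * |φ σ|) ^ 2 := by rw [mul_pow, Real.sq_sqrt h0, sq_abs]
      _ ≤ c ^ 2 := by gcongr
  have h2 : ‖h‖ ≤ a * ‖x‖ := hA.norm_spectralApply_le hM hφ x
  have h3 : inner ℝ (L h) h ≤ inner ℝ (A h) h + ε * (a * ‖x‖) ^ 2 := by
    have h4 : inner ℝ ((L - A) h) h ≤ ε * ‖h‖ ^ 2 := by
      refine (real_inner_le_norm _ _).trans ?_
      have h5 := (L - A).le_opNorm h
      rw [norm_sub_rev] at h5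
      have h6 : ‖(L - A) h‖ ≤ ε * ‖h‖ := h5.trans (by gcongr)
      calc _ ≤ ε * ‖h‖ * ‖h‖ := by gcongr
        _ = _ := by ring
    rw [sub_apply, inner_sub_left] at h4
    have h5 : ε * ‖h‖ ^ 2 ≤ ε * (a * ‖x‖) ^ 2 := by gcongr
    linarith
  refine le_of_sq_le_sq ?_ (by positivity)
  rw [hI]
  have h4 : 0 ≤ c * (√ε * a) * ‖x‖ ^ 2 := by positivity
  calc _ ≤ c ^ 2 * ‖x‖ ^ 2 + ε * (a * ‖x‖) ^ 2 := by linarith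
    _ = c ^ 2 * ‖x‖ ^ 2 + (√ε) ^ 2 * (a * ‖x‖) ^ 2 := by rw [Real.sq_sqrt hε0]
    _ ≤ _ := by nlinarith

end IsPosBounded

/-! ### Deterministic error bounds. -/

section Deterministic

variable {H : Type*} [NormedAddCommGroup H] [InnerProductSpace ℝ H] [CompleteSpace H]
  {L : H →L[ℝ] H} {κ : ℝ}

/-- Data for the error analysis at the scale `lam`: a polynomial `F` such that `f = F(L) u`. -/
theorem exists_source_polynomial (hκ : 0 < κ) (hL : IsPosBounded L (κ ^ 2)) {r : ℝ} (hr : 0 < r)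
    (f w : H) (hf : f = spectralApply L (fun σ => σ ^ r) w) :
    ∃ K : ℝ, 0 < K ∧ ∀ lam : ℝ, 0 < lam → lam ≤ κ ^ 2 → ∃ (F : Polynomial ℝ) (u : H),
      ‖u‖ ≤ K ∧ (∀ σ, 0 ≤ σ → σ ≤ κ ^ 2 → |F.eval σ| ≤ K * (σ ^ r + lam ^ r)) ∧
      ∀ A : H →L[ℝ] H, IsPosBounded A (κ ^ 2) →
        ‖Polynomial.aeval A F u - f‖ ≤ K / lam * ‖A - L‖ := by
  have hM : 0 < κ ^ 2 := by positivity
  obtain ⟨K, hK, h⟩ := exists_polynomial_power H hM hr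
  -- One constant for three bounds: `K` for the size of `F`, `K * ‖w‖` for `u`, and their product
  -- for the Lipschitz estimate applied to `u`.
  refine ⟨K + K * ‖w‖ + K * (K * ‖w‖), by positivity, fun lam h0 h1 => ?_⟩
  obtain ⟨F, hF, hlip⟩ := h lam h0 h1
  -- The source element is `u = (σ ^ r / F)(L) w`; since `F` dominates `σ ^ r`, its norm is bounded
  -- independently of `lam`.
  have hbd : ∀ σ, 0 ≤ σ → σ ≤ κ ^ 2 → |σ ^ r / F.eval σ| ≤ K := fun σ hσ0 hσ1 => by
    obtain ⟨h2, h3, -⟩ := hF σ hσ0 hσ1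
    rw [abs_of_nonneg (by positivity), div_le_iff₀ h2]
    exact h3
  have hu := hL.norm_spectralApply_le hM.le hbd w
  have hfu : Polynomial.aeval L F (spectralApply L (fun σ => σ ^ r / F.eval σ) w) = f := by
    rw [hL.aeval_spectralApply hM.le hbd, hf]
    refine hL.spectralApply_congr hM.le (fun σ hσ0 hσ1 => ?_) w
    have := (hF σ hσ0 hσ1).1
    field_simp
  refine ⟨F, spectralApply L (fun σ => σ ^ r / F.eval σ) w, ?_, fun σ hσ0 hσ1 => ?_,
    fun A hA => ?_⟩
  · have : 0 ≤ K * (K * ‖w‖) := by positivity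
    linarith
  · obtain ⟨h2, -, h3⟩ := hF σ hσ0 hσ1
    rw [abs_of_pos h2]
    refine h3.trans ?_
    gcongr
    have : 0 ≤ K * ‖w‖ + K * (K * ‖w‖) := by positivity
    linarith
  · rw [← hfu, ← sub_apply]
    have h2 := hlip A L hA hL
    calc _ ≤ ‖Polynomial.aeval A F - Polynomial.aeval L F‖ *
          ‖spectralApply L (fun σ => σ ^ r / F.eval σ) w‖ := ContinuousLinearMap.le_opNorm _ _
      _ ≤ K / lam * ‖A - L‖ * (K * ‖w‖) := by gcongr
      _ = (K * (K * ‖w‖)) / lam * ‖A - L‖ := by ring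
      _ ≤ _ := by
        gcongr
        have : 0 ≤ K + K * ‖w‖ := by positivity
        linarith

omit [CompleteSpace H] in
theorem norm_sub_apply_le {A : H →L[ℝ] H} {f b : H} {ε : ℝ} (h1 : ‖A - L‖ ≤ ε)
    (h2 : ‖b - L f‖ ≤ ε) : ‖b - A f‖ ≤ ε * (1 + ‖f‖) := by
  have h3 : b - A f = (b - L f) - (A - L) f := by simp
  rw [h3]
  refine (norm_sub_le _ _).trans ?_
  have h4 : ‖(A - L) f‖ ≤ ε * ‖f‖ := ((A - L).le_opNorm f).trans (by gcongr)
  linarith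

/-- The error bound in the norm of `H` on the event where the empirical quantities are close to
their means. -/
theorem exists_norm_error_bound (hκ : 0 < κ) (hL : IsPosBounded L (κ ^ 2)) {r : ℝ} (hr : 0 < r)
    {f w : H} (hf : f = spectralApply L (fun σ => σ ^ r) w) {g : ℝ → ℝ → ℝ}
    (hg : IsRegulariser κ g) {rbar : EReal} (hrbar : IsQualification κ g rbar)
    (hrr : (r : EReal) ≤ rbar) {a : ℝ} (ha : 0 < a) :
    ∃ C₁ : ℝ, ∀ lam : ℝ, 0 < lam → lam ≤ κ ^ 2 → ∀ ℓ : ℝ, 1 ≤ ℓ → ∀ (A : H →L[ℝ] H) (b : H),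
      IsPosBounded A (κ ^ 2) → IsCompactOperator A →
      ‖A - L‖ ≤ a * (lam ^ r * lam) * ℓ → ‖b - L f‖ ≤ a * (lam ^ r * lam) * ℓ →
      ‖spectralApply A (g lam) b - f‖ ≤ C₁ * lam ^ r * ℓ := by
  have hM : 0 < κ ^ 2 := by positivity
  obtain ⟨c, hc, hq⟩ := hrbar.exists_bound hg hr hrr
  obtain ⟨B, D, γ, hB, hD, hγ, hreg⟩ := hg.exists_bounds
  obtain ⟨K, hK, hsrc⟩ := exists_source_polynomial hκ hL hr f w hf
  refine ⟨B * a * (1 + ‖f‖) + K * (c + γ) * K + γ * K * a,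
    fun lam h0 h1 ℓ hℓ A b hA hAc h2 h3 => ?_⟩
  obtain ⟨F, u, hu, hF, hFA⟩ := hsrc lam h0 h1
  have hP : 0 < lam ^ r := by positivity
  have hF' : ∀ σ, 0 ≤ σ → σ ≤ κ ^ 2 → |F.eval σ| ≤ K * ((κ ^ 2) ^ r + lam ^ r) :=
    fun σ hσ0 hσ1 => (hF σ hσ0 hσ1).trans (by gcongr)
  have hg1 := fun σ hσ0 hσ1 => (hreg lam h0 h1 σ hσ0 hσ1).1
  have hg2 := fun σ hσ0 hσ1 => (hreg lam h0 h1 σ hσ0 hσ1).2.1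
  have hg3 := fun σ hσ0 hσ1 => (hreg lam h0 h1 σ hσ0 hσ1).2.2
  have hqF : ∀ σ, 0 ≤ σ → σ ≤ κ ^ 2 →
      |(1 - σ * g lam σ) * F.eval σ| ≤ K * (c + γ) * lam ^ r := fun σ hσ0 hσ1 =>
    abs_mul_le_of_abs_mul_rpow_le hK.le h0.le (hF σ hσ0 hσ1) (hq lam h0 h1 σ hσ0 hσ1)
      (hg3 σ hσ0 hσ1)
  rw [hA.spectralApply_sub_eq hM.le hAc hg1 hg2 hF' b f u]
  have t1 := hA.norm_spectralApply_le hM.le hg1 (b - A f)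
  have t2 := hA.norm_spectralApply_le hM.le hqF u
  have t3 := hA.norm_spectralApply_le hM.le hg3 (Polynomial.aeval A F u - f)
  have t4 := norm_sub_apply_le h2 h3
  have t5 := hFA A hA
  -- Here and in `e3` the deviation `lam ^ r * lam` cancels the `1 / lam`.
  have e1 : B / lam * ‖b - A f‖ ≤ B * a * (1 + ‖f‖) * (lam ^ r * ℓ) :=
    calc _ ≤ B / lam * (a * (lam ^ r * lam) * ℓ * (1 + ‖f‖)) := by gcongr
      _ = _ := by field_simp
  have e2 : K * (c + γ) * lam ^ r * ‖u‖ ≤ K * (c + γ) * K * (lam ^ r * ℓ) :=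
    calc _ ≤ K * (c + γ) * lam ^ r * K * 1 := by rw [mul_one]; gcongr
      _ ≤ K * (c + γ) * lam ^ r * K * ℓ := by gcongr
      _ = _ := by ring
  have e3 : γ * ‖Polynomial.aeval A F u - f‖ ≤ γ * K * a * (lam ^ r * ℓ) :=
    calc _ ≤ γ * (K / lam * (a * (lam ^ r * lam) * ℓ)) := by
          gcongr
          exact t5.trans (by gcongr)
      _ = _ := by field_simp
  calc _ ≤ _ := norm_add_le_of_le (norm_sub_le_of_le (t1.trans e1) (t2.trans e2)) (t3.trans e3)
    _ = _ := by ring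

/-- The error bound in the norm of `L²` on the event where the empirical quantities are close to
their means. -/
theorem exists_norm_apply_error_bound {E : Type*} [NormedAddCommGroup E] [NormedSpace ℝ E]
    (hκ : 0 < κ) (hL : IsPosBounded L (κ ^ 2)) {I : H →L[ℝ] E}
    (hI : ∀ h, ‖I h‖ ^ 2 = inner ℝ (L h) h) {r : ℝ} (hr : 0 < r)
    {f w : H} (hf : f = spectralApply L (fun σ => σ ^ r) w) {g : ℝ → ℝ → ℝ}
    (hg : IsRegulariser κ g) {rbar : EReal} (hrbar : IsQualification κ g rbar)
    (hrr : ((r + 1 / 2 : ℝ) : EReal) ≤ rbar) {a a' : ℝ} (ha : 0 < a) (ha' : 0 < a') :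
    ∃ C₂ : ℝ, ∀ lam : ℝ, 0 < lam → lam ≤ κ ^ 2 → ∀ ℓ : ℝ, 1 ≤ ℓ → ∀ (A : H →L[ℝ] H) (b : H),
      IsPosBounded A (κ ^ 2) → IsCompactOperator A → ‖A - L‖ ≤ a' * lam →
      ‖A - L‖ ≤ a * (lam ^ r * lam) * ℓ → ‖b - L f‖ ≤ a * (lam ^ r * lam) * ℓ →
      ‖I (spectralApply A (g lam) b - f)‖ ≤ C₂ * (lam ^ r * √lam) * ℓ := by
  have hM : 0 < κ ^ 2 := by positivity
  -- Three orders are used: `r` for `q F`, and `r + 1 / 2` and `1 / 2` for the two parts of `√σ q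
  -- F`; order `1 / 2` also serves `√σ q`.
  have hmono : ∀ ν : ℝ, ν ≤ r + 1 / 2 → (ν : EReal) ≤ rbar := fun ν hν =>
    (EReal.coe_le_coe_iff.2 hν).trans hrr
  obtain ⟨c, hc, hq⟩ := hrbar.exists_bound hg hr (hmono r (by linarith))
  obtain ⟨c₁, hc₁, hq₁⟩ := hrbar.exists_bound hg (ν := r + 1 / 2) (by positivity) hrr
  obtain ⟨c₂, hc₂, hq₂⟩ := hrbar.exists_bound hg (ν := 1 / 2) (by positivity)
    (hmono _ (by linarith))
  obtain ⟨B, D, γ, hB, hD, hγ, hreg⟩ := hg.exists_bounds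
  obtain ⟨K, hK, hsrc⟩ := exists_source_polynomial hκ hL hr f w hf
  refine ⟨(√(D * B) + √a' * B) * a * (1 + ‖f‖) + (K * (c₁ + c₂) + √a' * (K * (c + γ))) * K +
    (c₂ + √a' * γ) * K * a, fun lam h0 h1 ℓ hℓ A b hA hAc h4 h2 h3 => ?_⟩
  obtain ⟨F, u, hu, hF, hFA⟩ := hsrc lam h0 h1
  have hP : 0 < lam ^ r := by positivity
  have hs : 0 < √lam := Real.sqrt_pos.2 h0
  have hss : √lam * √lam = lam := Real.mul_self_sqrt h0.le
  have hsa : √(a' * lam) = √a' * √lam := Real.sqrt_mul ha'.le lam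
  have hF' : ∀ σ, 0 ≤ σ → σ ≤ κ ^ 2 → |F.eval σ| ≤ K * ((κ ^ 2) ^ r + lam ^ r) :=
    fun σ hσ0 hσ1 => (hF σ hσ0 hσ1).trans (by gcongr)
  have hg1 := fun σ hσ0 hσ1 => (hreg lam h0 h1 σ hσ0 hσ1).1
  have hg2 := fun σ hσ0 hσ1 => (hreg lam h0 h1 σ hσ0 hσ1).2.1
  have hg3 := fun σ hσ0 hσ1 => (hreg lam h0 h1 σ hσ0 hσ1).2.2
  have hhalf : ∀ x : ℝ, 0 ≤ x → x ^ (r + 1 / 2) = x ^ r * √x := fun x hx => by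
    rw [Real.rpow_add_of_nonneg hx hr.le (by norm_num), Real.sqrt_eq_rpow]
  have hr₁ : ∀ σ, 0 ≤ σ → σ ≤ κ ^ 2 →
      |1 - σ * g lam σ| * (σ ^ r * √σ) ≤ c₁ * (lam ^ r * √lam) := fun σ hσ0 hσ1 => by
    rw [← hhalf σ hσ0, ← hhalf lam h0.le]
    exact hq₁ lam h0 h1 σ hσ0 hσ1
  have hr₂ : ∀ σ, 0 ≤ σ → σ ≤ κ ^ 2 →
      √σ * |1 - σ * g lam σ| ≤ c₂ * √lam := fun σ hσ0 hσ1 => by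
    rw [mul_comm, Real.sqrt_eq_rpow, Real.sqrt_eq_rpow]
    exact hq₂ lam h0 h1 σ hσ0 hσ1
  have hqF : ∀ σ, 0 ≤ σ → σ ≤ κ ^ 2 →
      |(1 - σ * g lam σ) * F.eval σ| ≤ K * (c + γ) * lam ^ r := fun σ hσ0 hσ1 =>
    abs_mul_le_of_abs_mul_rpow_le hK.le h0.le (hF σ hσ0 hσ1) (hq lam h0 h1 σ hσ0 hσ1)
      (hg3 σ hσ0 hσ1)
  have hqF' : ∀ σ, 0 ≤ σ → σ ≤ κ ^ 2 →
      √σ * |(1 - σ * g lam σ) * F.eval σ| ≤ K * (c₁ + c₂) * (lam ^ r * √lam) :=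
    fun σ hσ0 hσ1 => by
    rw [abs_mul]
    calc _ ≤ √σ * (|1 - σ * g lam σ| * (K * (σ ^ r + lam ^ r))) := by
          gcongr
          exact hF σ hσ0 hσ1
      _ = K * (|1 - σ * g lam σ| * (σ ^ r * √σ) + √σ * |1 - σ * g lam σ| * lam ^ r) := by ring
      _ ≤ K * (c₁ * (lam ^ r * √lam) + c₂ * √lam * lam ^ r) := by
          gcongr K * (?_ + ?_ * _)
          · exact hr₁ σ hσ0 hσ1
          · exact hr₂ σ hσ0 hσ1
      _ = _ := by ring
  -- Geometric mean of the bounds `D` on `σ g` and `B / lam` on `g`.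
  have hg' : ∀ σ, 0 ≤ σ → σ ≤ κ ^ 2 → √σ * |g lam σ| ≤ √(D * B) / √lam := fun σ hσ0 hσ1 => by
    rw [← Real.sqrt_div' _ h0.le]
    refine Real.le_sqrt_of_sq_le ?_
    calc (√σ * |g lam σ|) ^ 2 = |σ * g lam σ| * |g lam σ| := by
          rw [mul_pow, Real.sq_sqrt hσ0, abs_mul, abs_of_nonneg hσ0]
          ring
      _ ≤ D * (B / lam) := by
          gcongr
          · exact hg2 σ hσ0 hσ1
          · exact hg1 σ hσ0 hσ1
      _ = _ := by ring
  rw [hA.spectralApply_sub_eq hM.le hAc hg1 hg2 hF' b f u, map_add, map_sub]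
  have t1 := hA.norm_apply_spectralApply_le hM.le hI (by positivity) hg1 hg' h4 (b - A f)
  have t2 := hA.norm_apply_spectralApply_le hM.le hI (by positivity) hqF hqF' h4 u
  have t3 := hA.norm_apply_spectralApply_le hM.le hI (by positivity) hg3 hr₂ h4
    (Polynomial.aeval A F u - f)
  rw [hsa] at t1 t2 t3
  have t4 := norm_sub_apply_le h2 h3
  have t5 := hFA A hA
  have e1 : (√(D * B) / √lam + √a' * √lam * (B / lam)) * ‖b - A f‖ ≤
      (√(D * B) + √a' * B) * a * (1 + ‖f‖) * (lam ^ r * √lam * ℓ) :=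
    calc _ ≤ (√(D * B) / √lam + √a' * √lam * (B / lam)) *
          (a * (lam ^ r * lam) * ℓ * (1 + ‖f‖)) := by gcongr
      _ = (√(D * B) / √lam + √a' * √lam * (B / (√lam * √lam))) *
          (a * (lam ^ r * (√lam * √lam)) * ℓ * (1 + ‖f‖)) := by rw [hss]
      _ = _ := by field_simp
  have e2 : (K * (c₁ + c₂) * (lam ^ r * √lam) + √a' * √lam * (K * (c + γ) * lam ^ r)) * ‖u‖ ≤
      (K * (c₁ + c₂) + √a' * (K * (c + γ))) * K * (lam ^ r * √lam * ℓ) :=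
    calc _ ≤ (K * (c₁ + c₂) * (lam ^ r * √lam) + √a' * √lam * (K * (c + γ) * lam ^ r)) * K * 1 := by
          rw [mul_one]; gcongr
      _ ≤ (K * (c₁ + c₂) * (lam ^ r * √lam) + √a' * √lam * (K * (c + γ) * lam ^ r)) * K * ℓ := by
          gcongr
      _ = _ := by ring
  have e3 : (c₂ * √lam + √a' * √lam * γ) * ‖Polynomial.aeval A F u - f‖ ≤
      (c₂ + √a' * γ) * K * a * (lam ^ r * √lam * ℓ) :=
    calc _ ≤ (c₂ * √lam + √a' * √lam * γ) * (K / lam * (a * (lam ^ r * lam) * ℓ)) := by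
          gcongr
          exact t5.trans (by gcongr)
      _ = _ := by field_simp
  calc _ ≤ _ := norm_add_le_of_le (norm_sub_le_of_le (t1.trans e1) (t2.trans e2)) (t3.trans e3)
    _ = _ := by ring

end Deterministic

/-! ### Concentration of means in Hilbert space. -/

section Concentration

variable {α E : Type*} [MeasurableSpace α] [NormedAddCommGroup E] [InnerProductSpace ℝ E]
  {μ : Measure α} [IsProbabilityMeasure μ] {X : α → E} {c : ℝ}

/-- Hoeffding's lemma for the scalar variable `⟨x, X⟩`, centred with values in `[-‖x‖ c, ‖x‖ c]`. -/
theorem lintegral_exp_inner_le (hX : StronglyMeasurable X) (hc : ∀ a, ‖X a‖ ≤ c)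
    (h0 : ∀ x, ∫ a, inner ℝ x (X a) ∂μ = 0) (x : E) (t : ℝ) :
    ∫⁻ a, ENNReal.ofReal (Real.exp (t * inner ℝ x (X a))) ∂μ ≤
      ENNReal.ofReal (Real.exp ((‖x‖ * c) ^ 2 * t ^ 2 / 2)) := by
  have hm : Measurable fun a => inner ℝ x (X a) :=
    (stronglyMeasurable_const.inner hX).measurable
  have hb : ∀ᵐ a ∂μ, inner ℝ x (X a) ∈ Set.Icc (-(‖x‖ * c)) (‖x‖ * c) :=
    Filter.Eventually.of_forall fun a => abs_le.1
      ((abs_real_inner_le_norm _ _).trans (mul_le_mul_of_nonneg_left (hc a) (norm_nonneg _)))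
  have h := hasSubgaussianMGF_of_mem_Icc_of_integral_eq_zero hm.aemeasurable hb (h0 x)
  rw [← ofReal_integral_eq_lintegral_ofReal (h.integrable_exp_mul t)
    (Filter.Eventually.of_forall fun _ => (Real.exp_pos _).le)]
  refine ENNReal.ofReal_le_ofReal ((h.mgf_le t).trans (le_of_eq ?_))
  congr 3
  push_cast
  rw [Real.norm_eq_abs, div_pow, sq_abs]
  ring

/-- After expanding the square, only the cross term is random beyond the bound `c²`, and Hoeffding's
lemma with `t = 2 θ` handles it. One added vector thus replaces `θ` by `θ (1 + 2 θ c²)`. -/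
theorem lintegral_exp_norm_add_sq_le (hX : StronglyMeasurable X) (hc : ∀ a, ‖X a‖ ≤ c)
    (h0 : ∀ x, ∫ a, inner ℝ x (X a) ∂μ = 0) (x : E) {θ : ℝ} (hθ : 0 ≤ θ) :
    ∫⁻ a, ENNReal.ofReal (Real.exp (θ * ‖X a + x‖ ^ 2)) ∂μ ≤
      ENNReal.ofReal (Real.exp (θ * c ^ 2)) *
        ENNReal.ofReal (Real.exp (θ * (1 + 2 * θ * c ^ 2) * ‖x‖ ^ 2)) := by
  have h1 : ∀ a, ENNReal.ofReal (Real.exp (θ * ‖X a + x‖ ^ 2)) ≤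
      ENNReal.ofReal (Real.exp (θ * (‖x‖ ^ 2 + c ^ 2))) *
        ENNReal.ofReal (Real.exp ((2 * θ) * inner ℝ x (X a))) := fun a => by
    rw [← ENNReal.ofReal_mul (Real.exp_pos _).le, ← Real.exp_add]
    refine ENNReal.ofReal_le_ofReal (Real.exp_le_exp.2 ?_)
    rw [add_comm (X a), norm_add_sq_real]
    have h2 : ‖X a‖ ^ 2 ≤ c ^ 2 := by
      have := hc a
      gcongr
    nlinarith
  refine (lintegral_mono h1).trans ?_
  rw [lintegral_const_mul' _ _ ENNReal.ofReal_ne_top]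
  refine (mul_le_mul_right (lintegral_exp_inner_le hX hc h0 x (2 * θ)) _).trans (le_of_eq ?_)
  rw [← ENNReal.ofReal_mul (Real.exp_pos _).le, ← Real.exp_add,
    ← ENNReal.ofReal_mul (Real.exp_pos _).le, ← Real.exp_add]
  ring_nf

/-- Sub-Gaussian bound for the squared norm of a sum of i.i.d. bounded centred vectors. -/
theorem lintegral_exp_norm_sum_sq_le (hX : StronglyMeasurable X) (hc : ∀ a, ‖X a‖ ≤ c)
    (h0 : ∀ x, ∫ a, inner ℝ x (X a) ∂μ = 0) (n : ℕ) {θ : ℝ} (hθ : 0 ≤ θ)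
    (hn : 4 * c ^ 2 * θ * n ≤ 1) :
    ∫⁻ z : Fin n → α, ENNReal.ofReal (Real.exp (θ * ‖∑ i, X (z i)‖ ^ 2))
      ∂(Measure.pi fun _ => μ) ≤ ENNReal.ofReal (Real.exp (2 * θ * c ^ 2 * n)) := by
  induction n generalizing θ with
  | zero => simp
  | succ n ih =>
    have hsum : StronglyMeasurable fun z : Fin n → α => ∑ i, X (z i) :=
      Finset.stronglyMeasurable_fun_sum _ fun i _ => hX.comp_measurable (measurable_pi_apply i)
    have hs₁ : StronglyMeasurable fun p : α × (Fin n → α) => X p.1 :=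
      hX.comp_measurable measurable_fst
    have hs₂ : StronglyMeasurable fun p : α × (Fin n → α) => ∑ i, X (p.2 i) :=
      hsum.comp_measurable measurable_snd
    have hs : Measurable fun p : α × (Fin n → α) => ‖X p.1 + ∑ i, X (p.2 i)‖ :=
      (hs₁.add hs₂).norm.measurable
    have hmeas : Measurable fun p : α × (Fin n → α) =>
        ENNReal.ofReal (Real.exp (θ * ‖X p.1 + ∑ i, X (p.2 i)‖ ^ 2)) := by
      fun_prop
    have hmp : MeasurePreserving (fun z : Fin (n + 1) → α => (z 0, fun i : Fin n => z i.succ))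
        (Measure.pi fun _ => μ) (μ.prod (Measure.pi fun _ => μ)) :=
      measurePreserving_piFinSuccAbove (fun _ : Fin (n + 1) => μ) 0
    have h1 := hmp.lintegral_comp hmeas
    simp only [Fin.sum_univ_succ]
    rw [h1]
    rw [lintegral_prod_symm' _ hmeas]
    have hstep : ∀ z : Fin n → α,
        ∫⁻ a, ENNReal.ofReal (Real.exp (θ * ‖X a + ∑ i, X (z i)‖ ^ 2)) ∂μ ≤
          ENNReal.ofReal (Real.exp (θ * c ^ 2)) *
            ENNReal.ofReal (Real.exp (θ * (1 + 2 * θ * c ^ 2) * ‖∑ i, X (z i)‖ ^ 2)) := fun z =>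
      lintegral_exp_norm_add_sq_le hX hc h0 (∑ i, X (z i)) hθ
    refine (lintegral_mono hstep).trans ?_
    rw [lintegral_const_mul' _ _ ENNReal.ofReal_ne_top]
    have hn0 : (0 : ℝ) ≤ n := n.cast_nonneg
    set a : ℝ := 4 * c ^ 2 * θ with ha
    have ha0 : 0 ≤ a := by positivity
    push_cast at hn ⊢
    have h2 : a * n ≤ 1 := by nlinarith
    -- The enlarged parameter is still admissible for `n` vectors: `a n (1 + a / 2) ≤ a n + a / 2 ≤
    -- a (n + 1) ≤ 1`.
    have h3 : 4 * c ^ 2 * (θ * (1 + 2 * θ * c ^ 2)) * n ≤ 1 := by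
      have h4 : 4 * c ^ 2 * (θ * (1 + 2 * θ * c ^ 2)) * n = a * n * (1 + a / 2) := by
        rw [ha]; ring
      rw [h4]
      nlinarith
    refine (mul_le_mul_right (ih (by positivity) h3) _).trans ?_
    rw [← ENNReal.ofReal_mul (Real.exp_pos _).le, ← Real.exp_add]
    refine ENNReal.ofReal_le_ofReal (Real.exp_le_exp.2 ?_)
    have h5 : 2 * (θ * (1 + 2 * θ * c ^ 2)) * c ^ 2 * n = 2 * θ * c ^ 2 * n +
        (a * n) * (θ * c ^ 2) := by rw [ha]; ring
    rw [h5]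
    have h6 : (a * n) * (θ * c ^ 2) ≤ 1 * (θ * c ^ 2) := by gcongr
    linarith

/-- Tail bound for the mean of i.i.d. bounded centred vectors. -/
theorem pi_norm_mean_tail (hX : StronglyMeasurable X) (hc0 : 0 < c) (hc : ∀ a, ‖X a‖ ≤ c)
    (h0 : ∀ x, ∫ a, inner ℝ x (X a) ∂μ = 0) {n : ℕ} (hn : 0 < n) {ℓ : ℝ} (hℓ : 1 ≤ ℓ) :
    (Measure.pi fun _ : Fin n => μ) {z | 3 * c * ℓ / √n < ‖(n : ℝ)⁻¹ • ∑ i, X (z i)‖} ≤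
      ENNReal.ofReal (2 * Real.exp (-(2 * ℓ))) := by
  have hn' : (0 : ℝ) < n := Nat.cast_pos.2 hn
  -- The largest admissible `θ`. The exponential moment is then at most `e ^ (1 / 2) ≤ 2`, and at
  -- the threshold the exponent is `9 / 4 * ℓ ^ 2 ≥ 2 * ℓ`.
  set θ : ℝ := 1 / (4 * c ^ 2 * n) with hθ
  have hθ0 : 0 ≤ θ := by positivity
  have h1 := lintegral_exp_norm_sum_sq_le (μ := μ) hX hc h0 n hθ0
    (by rw [hθ]; field_simp; rfl)
  have hsum : StronglyMeasurable fun z : Fin n → α => ∑ i, X (z i) :=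
    Finset.stronglyMeasurable_fun_sum _ fun i _ => hX.comp_measurable (measurable_pi_apply i)
  have hmeas : Measurable fun z : Fin n → α =>
      ENNReal.ofReal (Real.exp (θ * ‖∑ i, X (z i)‖ ^ 2)) :=
    (Real.measurable_exp.comp ((hsum.norm.measurable.pow_const 2).const_mul θ)).ennreal_ofReal
  have h2 : {z : Fin n → α | 3 * c * ℓ / √n < ‖(n : ℝ)⁻¹ • ∑ i, X (z i)‖} ⊆
      {z | ENNReal.ofReal (Real.exp (2 * ℓ)) ≤
        ENNReal.ofReal (Real.exp (θ * ‖∑ i, X (z i)‖ ^ 2))} := by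
    intro z hz
    refine ENNReal.ofReal_le_ofReal (Real.exp_le_exp.2 ?_)
    rw [Set.mem_ofPred_eq, norm_smul, Real.norm_eq_abs, abs_of_pos (by positivity)] at hz
    have h3 : 3 * c * ℓ * √n ≤ ‖∑ i, X (z i)‖ := by
      have h4 : 3 * c * ℓ / √n = (n : ℝ)⁻¹ * (3 * c * ℓ * √n) := by
        field_simp
        rw [Real.sq_sqrt hn'.le]
      rw [h4] at hz
      exact (lt_of_mul_lt_mul_left hz (by positivity)).le
    have h5 : (3 * c * ℓ * √n) ^ 2 ≤ ‖∑ i, X (z i)‖ ^ 2 := by gcongr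
    rw [mul_pow, Real.sq_sqrt hn'.le] at h5
    calc 2 * ℓ ≤ 9 / 4 * ℓ ^ 2 := by nlinarith
      _ = θ * ((3 * c * ℓ) ^ 2 * n) := by rw [hθ]; field_simp; norm_num
      _ ≤ _ := by gcongr
  refine (measure_mono h2).trans ((meas_ge_le_lintegral_div hmeas.aemeasurable
    (by simp [Real.exp_pos]) ENNReal.ofReal_ne_top).trans ?_)
  refine ENNReal.div_le_of_le_mul (h1.trans ?_)
  rw [← ENNReal.ofReal_mul (by positivity)]
  refine ENNReal.ofReal_le_ofReal ?_
  rw [mul_assoc (2 : ℝ) (Real.exp _), ← Real.exp_add, neg_add_cancel, Real.exp_zero, mul_one]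
  have h6 : 2 * θ * c ^ 2 * n = 1 / 2 := by rw [hθ]; field_simp; norm_num
  rw [h6]
  have h7 := Real.exp_one_lt_d9
  have h8 : Real.exp (1 / 2) ^ 2 = Real.exp 1 := by rw [← Real.exp_nat_mul]; norm_num
  have h9 := Real.exp_pos (1 / 2)
  nlinarith

theorem norm_sub_integral_le (hc : ∀ a, ‖X a‖ ≤ c) (a : α) : ‖X a - ∫ b, X b ∂μ‖ ≤ 2 * c := by
  have h := norm_integral_le_of_norm_le_const (μ := μ) (Filter.Eventually.of_forall hc)
  rw [probReal_univ, mul_one] at h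
  linarith [norm_sub_le_of_le (hc a) h]

variable [CompleteSpace E]

theorem integral_inner_sub_integral (hX : StronglyMeasurable X) (hc : ∀ a, ‖X a‖ ≤ c) (x : E) :
    ∫ a, inner ℝ x (X a - ∫ b, X b ∂μ) ∂μ = 0 := by
  have hi : Integrable X μ :=
    Integrable.of_bound hX.aestronglyMeasurable c (Filter.Eventually.of_forall hc)
  have h := integral_inner (𝕜 := ℝ) (hi.sub (integrable_const (∫ b, X b ∂μ))) x
  simp only [Pi.sub_apply] at h
  rw [h, integral_sub hi (integrable_const _)]
  simp

theorem pi_norm_mean_sub_integral_tail (hX : StronglyMeasurable X) (hc0 : 0 < c)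
    (hc : ∀ a, ‖X a‖ ≤ c) {n : ℕ} (hn : 0 < n) {ℓ : ℝ} (hℓ : 1 ≤ ℓ) :
    (Measure.pi fun _ : Fin n => μ)
      {z | 6 * c * ℓ / √n < ‖(n : ℝ)⁻¹ • ∑ i, X (z i) - ∫ a, X a ∂μ‖} ≤
      ENNReal.ofReal (2 * Real.exp (-(2 * ℓ))) := by
  have h := pi_norm_mean_tail (μ := μ) (X := fun a => X a - ∫ b, X b ∂μ) (c := 2 * c)
    (hX.sub stronglyMeasurable_const) (by positivity) (norm_sub_integral_le hc)
    (integral_inner_sub_integral hX hc) hn hℓ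
  have hn' : (n : ℝ) ≠ 0 := Nat.cast_ne_zero.2 hn.ne'
  have h1 : ∀ z : Fin n → α, (n : ℝ)⁻¹ • ∑ i, (X (z i) - ∫ b, X b ∂μ) =
      (n : ℝ)⁻¹ • ∑ i, X (z i) - ∫ a, X a ∂μ := fun z => by
    rw [Finset.sum_sub_distrib, smul_sub, Finset.sum_const, Finset.card_univ, Fintype.card_fin,
      ← Nat.cast_smul_eq_nsmul ℝ, smul_smul, inv_mul_cancel₀ hn', one_smul]
  simp only [h1] at h
  convert h using 5
  ring

/-- Tail bound for the mean over a product grid of two independent i.i.d. samples. -/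
theorem prod_norm_mean_sub_integral_tail {β : Type*} [MeasurableSpace β] {ν : Measure β}
    [IsProbabilityMeasure ν] {X : α × β → E} (hX : StronglyMeasurable X) (hc0 : 0 < c)
    (hc : ∀ a, ‖X a‖ ≤ c) {n m : ℕ} (hn : 0 < n) (hm : 0 < m) {ℓ : ℝ} (hℓ : 1 ≤ ℓ) :
    ((Measure.pi fun _ : Fin n => μ).prod (Measure.pi fun _ : Fin m => ν))
      {z | 6 * c * ℓ * (1 / √n + 1 / √m) <
        ‖(n * m : ℝ)⁻¹ • ∑ i, ∑ j, X (z.1 i, z.2 j) - ∫ p, X p ∂(μ.prod ν)‖} ≤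
      ENNReal.ofReal (4 * Real.exp (-(2 * ℓ))) := by
  have hn' : (n : ℝ) ≠ 0 := Nat.cast_ne_zero.2 hn.ne'
  have hi : Integrable X (μ.prod ν) :=
    Integrable.of_bound hX.aestronglyMeasurable c (Filter.Eventually.of_forall hc)
  set Xbar : α → E := fun a => ∫ b, X (a, b) ∂ν with hXbar
  have hXbar_meas : StronglyMeasurable Xbar := hX.integral_prod_right'
  have hXbar_le : ∀ a, ‖Xbar a‖ ≤ c := fun a => by
    have h := norm_integral_le_of_norm_le_const (μ := ν)
      (Filter.Eventually.of_forall fun b => hc (a, b))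
    rwa [probReal_univ, mul_one] at h
  have hint : ∫ a, Xbar a ∂μ = ∫ p, X p ∂(μ.prod ν) := (integral_prod X hi).symm
  set S₁ : Set (Fin n → α) :=
    {x | 6 * c * ℓ / √n < ‖(n : ℝ)⁻¹ • ∑ i, Xbar (x i) - ∫ a, Xbar a ∂μ‖} with hS₁
  -- For fixed `x` the grid mean is an i.i.d. mean of `Y x` over the second sample, with the same
  -- bound `c` and expectation the mean of `Xbar (x i)`.
  set Y : (Fin n → α) → β → E := fun x b => (n : ℝ)⁻¹ • ∑ i, X (x i, b) with hY
  have hYm : StronglyMeasurable (Function.uncurry Y) :=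
    (Finset.stronglyMeasurable_fun_sum _ fun i _ => hX.comp_measurable
      (((measurable_pi_apply i).comp measurable_fst).prodMk measurable_snd)).const_smul _
  have hYc : ∀ x b, ‖Y x b‖ ≤ c := fun x b => by
    rw [hY]
    simp only [norm_smul, Real.norm_eq_abs,
      abs_of_nonneg (inv_nonneg.2 (Nat.cast_nonneg (α := ℝ) n))]
    rw [inv_mul_le_iff₀ (by positivity)]
    refine (norm_sum_le_of_le (f := fun i => X (x i, b)) Finset.univ
      fun i _ => hc (x i, b)).trans ?_
    simp
  have hYint : ∀ x, ∫ b, Y x b ∂ν = (n : ℝ)⁻¹ • ∑ i, Xbar (x i) := fun x => by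
    rw [hY]
    simp only
    rw [integral_smul, integral_finsetSum]
    intro i _
    exact Integrable.of_bound (hX.comp_measurable measurable_prodMk_left).aestronglyMeasurable c
      (Filter.Eventually.of_forall fun b => hc (x i, b))
  set S₂ : Set ((Fin n → α) × (Fin m → β)) :=
    {z | 6 * c * ℓ / √m < ‖(m : ℝ)⁻¹ • ∑ j, Y z.1 (z.2 j) - (n : ℝ)⁻¹ • ∑ i, Xbar (z.1 i)‖}
    with hS₂
  have hXbarS : StronglyMeasurable fun x : Fin n → α => (n : ℝ)⁻¹ • ∑ i, Xbar (x i) :=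
    (Finset.stronglyMeasurable_fun_sum _ fun i _ => hXbar_meas.comp_measurable
      (measurable_pi_apply i)).const_smul _
  have hS₂m : MeasurableSet S₂ := by
    refine measurableSet_lt measurable_const (StronglyMeasurable.measurable ?_)
    refine StronglyMeasurable.norm (StronglyMeasurable.sub (StronglyMeasurable.const_smul
      (Finset.stronglyMeasurable_fun_sum _ fun j _ => ?_) _)
      (hXbarS.comp_measurable measurable_fst))
    exact hYm.comp_measurable
      (measurable_fst.prodMk ((measurable_pi_apply j).comp measurable_snd))
  have h1 : ((Measure.pi fun _ : Fin n => μ).prod (Measure.pi fun _ : Fin m => ν))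
      (Prod.fst ⁻¹' S₁) ≤ ENNReal.ofReal (2 * Real.exp (-(2 * ℓ))) := by
    have hS₁m : MeasurableSet S₁ :=
      measurableSet_lt measurable_const (hXbarS.sub stronglyMeasurable_const).norm.measurable
    rw [measurePreserving_fst.measure_preimage hS₁m.nullMeasurableSet]
    exact pi_norm_mean_sub_integral_tail hXbar_meas hc0 hXbar_le hn hℓ
  have h2 : ((Measure.pi fun _ : Fin n => μ).prod (Measure.pi fun _ : Fin m => ν)) S₂ ≤
      ENNReal.ofReal (2 * Real.exp (-(2 * ℓ))) := by
    rw [Measure.prod_apply hS₂m]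
    refine (lintegral_mono (g := fun _ => ENNReal.ofReal (2 * Real.exp (-(2 * ℓ))))
      fun x => ?_).trans (by simp)
    have h := pi_norm_mean_sub_integral_tail (μ := ν) (X := Y x)
      (hYm.comp_measurable measurable_prodMk_left) hc0 (hYc x) hm hℓ
    rw [hYint] at h
    exact h
  have hsub : {z : (Fin n → α) × (Fin m → β) | 6 * c * ℓ * (1 / √n + 1 / √m) <
      ‖(n * m : ℝ)⁻¹ • ∑ i, ∑ j, X (z.1 i, z.2 j) - ∫ p, X p ∂(μ.prod ν)‖} ⊆
      Prod.fst ⁻¹' S₁ ∪ S₂ := by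
    intro z hz
    by_contra hcon
    simp only [hS₁, hS₂, Set.mem_union, Set.mem_preimage, Set.mem_ofPred_eq, not_or, not_lt] at hcon
    obtain ⟨hc1, hc2⟩ := hcon
    have heq : (n * m : ℝ)⁻¹ • ∑ i, ∑ j, X (z.1 i, z.2 j) - ∫ p, X p ∂(μ.prod ν) =
        ((m : ℝ)⁻¹ • ∑ j, Y z.1 (z.2 j) - (n : ℝ)⁻¹ • ∑ i, Xbar (z.1 i)) +
        ((n : ℝ)⁻¹ • ∑ i, Xbar (z.1 i) - ∫ a, Xbar a ∂μ) := by
      rw [sub_add_sub_cancel, hint, Finset.sum_comm, mul_inv, mul_comm, mul_smul, Finset.smul_sum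
        (r := (n : ℝ)⁻¹)]
    rw [Set.mem_ofPred_eq, heq] at hz
    have h3 := norm_add_le_of_le hc2 hc1
    have h4 : 6 * c * ℓ * (1 / √n + 1 / √m) = 6 * c * ℓ / √m + 6 * c * ℓ / √n := by ring
    rw [h4] at hz
    exact absurd h3 (not_le.2 hz)
  calc _ ≤ _ := measure_mono hsub
    _ ≤ _ := measure_union_le _ _
    _ ≤ _ := add_le_add h1 h2
    _ = _ := by
      rw [← ENNReal.ofReal_add (by positivity) (by positivity)]
      ring_nf

end Concentration

/-! ### Transfer to samples on a probability space. -/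

section Samples

variable {α E Ω : Type*} [MeasurableSpace α] [MeasurableSpace Ω] {P : Measure Ω}
  [IsProbabilityMeasure P] {μ : Measure α} [IsProbabilityMeasure μ]

omit [IsProbabilityMeasure μ] in
theorem IsIIDSample.map_eq_pi {n : ℕ} {x : Fin n → Ω → α} (hx : IsIIDSample P μ x) :
    P.map (fun ω i => x i ω) = Measure.pi fun _ => μ := by
  rw [(iIndepFun_iff_map_fun_eq_pi_map fun i => (hx.1 i).aemeasurable).1 hx.2.2]
  simp only [hx.2.1]

variable [NormedAddCommGroup E] {c : ℝ}

-- Truncating a measurable version keeps the bound at every point, so that the tail bounds on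
-- product spaces, stated for strongly measurable bounded functions, apply.
omit [IsProbabilityMeasure μ] in
theorem exists_stronglyMeasurable_norm_le {X : α → E} (hX : AEStronglyMeasurable X μ)
    (hc0 : 0 ≤ c) (hc : ∀ a, ‖X a‖ ≤ c) :
    ∃ Y : α → E, StronglyMeasurable Y ∧ (∀ a, ‖Y a‖ ≤ c) ∧ X =ᵐ[μ] Y := by
  have hm := hX.stronglyMeasurable_mk
  refine ⟨{a | ‖hX.mk X a‖ ≤ c}.indicator (hX.mk X),
    hm.indicator (measurableSet_le hm.norm.measurable measurable_const), fun a => ?_, ?_⟩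
  · by_cases ha : ‖hX.mk X a‖ ≤ c
    · rwa [Set.indicator_of_mem (by exact ha)]
    · rwa [Set.indicator_of_notMem (by exact ha), norm_zero]
  · filter_upwards [hX.ae_eq_mk] with a ha
    rw [Set.indicator_of_mem, ha]
    rw [Set.mem_ofPred_eq, ← ha]
    exact hc a

variable [InnerProductSpace ℝ E] [CompleteSpace E]

theorem IsIIDSample.norm_mean_sub_integral_tail {n : ℕ} {z : Fin n → Ω → α}
    (hz : IsIIDSample P μ z) {X : α → E} (hX : AEStronglyMeasurable X μ) (hc0 : 0 < c)
    (hc : ∀ a, ‖X a‖ ≤ c) (hn : 0 < n) {ℓ : ℝ} (hℓ : 1 ≤ ℓ) :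
    P {ω | 6 * c * ℓ / √n < ‖(n : ℝ)⁻¹ • ∑ i, X (z i ω) - ∫ a, X a ∂μ‖} ≤
      ENNReal.ofReal (2 * Real.exp (-(2 * ℓ))) := by
  obtain ⟨Y, hYm, hYc, hXY⟩ := exists_stronglyMeasurable_norm_le hX hc0.le hc
  have h1 : ∀ᵐ ω ∂P, ∀ i, X (z i ω) = Y (z i ω) := by
    rw [ae_all_iff]
    intro i
    exact ae_of_ae_map (f := z i) (p := fun a => X a = Y a) (hz.1 i).aemeasurable
      (by rw [hz.2.1 i]; exact hXY)
  have h2 := pi_norm_mean_sub_integral_tail (μ := μ) hYm hc0 hYc hn hℓ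
  rw [← hz.map_eq_pi] at h2
  -- This inequality holds for arbitrary sets, so the event need not be shown measurable.
  refine le_trans ?_ ((Measure.le_map_apply
    (measurable_pi_iff.2 hz.1).aemeasurable _).trans h2)
  refine measure_mono_ae ?_
  filter_upwards [h1] with ω hω hmem
  have hmem' : 6 * c * ℓ / √n < ‖(n : ℝ)⁻¹ • ∑ i, X (z i ω) - ∫ a, X a ∂μ‖ := hmem
  simp only [hω, integral_congr_ae hXY] at hmem'
  exact hmem'

theorem IsIIDSample.norm_grid_mean_sub_integral_tail {β : Type*} [MeasurableSpace β]
    {ν : Measure β} [IsProbabilityMeasure ν] {n m : ℕ} {x : Fin n → Ω → α} {u : Fin m → Ω → β}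
    (hx : IsIIDSample P μ x) (hu : IsIIDSample P ν u)
    (hxu : IndepFun (fun ω i => x i ω) (fun ω j => u j ω) P) {X : α × β → E}
    (hX : AEStronglyMeasurable X (μ.prod ν)) (hc0 : 0 < c)
    (hc : ∀ a, ‖X a‖ ≤ c) (hn : 0 < n) (hm : 0 < m) {ℓ : ℝ} (hℓ : 1 ≤ ℓ) :
    P {ω | 6 * c * ℓ * (1 / √n + 1 / √m) <
        ‖(n * m : ℝ)⁻¹ • ∑ i, ∑ j, X (x i ω, u j ω) - ∫ p, X p ∂(μ.prod ν)‖} ≤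
      ENNReal.ofReal (4 * Real.exp (-(2 * ℓ))) := by
  obtain ⟨Y, hYm, hYc, hXY⟩ := exists_stronglyMeasurable_norm_le hX hc0.le hc
  have hxm : Measurable fun ω i => x i ω := measurable_pi_iff.2 hx.1
  have hum : Measurable fun ω j => u j ω := measurable_pi_iff.2 hu.1
  have h1 : ∀ᵐ ω ∂P, ∀ i j, X (x i ω, u j ω) = Y (x i ω, u j ω) := by
    rw [ae_all_iff]
    intro i
    rw [ae_all_iff]
    intro j
    have hij : IndepFun (x i) (u j) P :=
      hxu.comp (measurable_pi_apply i) (measurable_pi_apply j)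
    have hmap := (indepFun_iff_map_prod_eq_prod_map_map (hx.1 i).aemeasurable
      (hu.1 j).aemeasurable).1 hij
    rw [hx.2.1, hu.2.1] at hmap
    have h := ae_of_ae_map (f := fun ω => (x i ω, u j ω)) (p := fun p => X p = Y p)
      ((hx.1 i).prodMk (hu.1 j)).aemeasurable (by rw [hmap]; exact hXY)
    exact h
  have h2 := prod_norm_mean_sub_integral_tail (μ := μ) (ν := ν) hYm hc0 hYc hn hm hℓ
  have hmap := (indepFun_iff_map_prod_eq_prod_map_map hxm.aemeasurable hum.aemeasurable).1 hxu
  rw [hx.map_eq_pi, hu.map_eq_pi] at hmap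
  rw [← hmap] at h2
  refine le_trans ?_ ((Measure.le_map_apply (hxm.prodMk hum).aemeasurable _).trans h2)
  refine measure_mono_ae ?_
  filter_upwards [h1] with ω hω hmem
  have hmem' : 6 * c * ℓ * (1 / √n + 1 / √m) <
    ‖(n * m : ℝ)⁻¹ • ∑ i, ∑ j, X (x i ω, u j ω) - ∫ p, X p ∂(μ.prod ν)‖ := hmem
  simp only [hω, integral_congr_ae hXY] at hmem'
  exact hmem'

end Samples

/-! ### Measurability from pointwise evaluations. -/

section Measurability

variable {α H : Type*} [MeasurableSpace α] {ν : Measure α} [NormedAddCommGroup H]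
  [InnerProductSpace ℝ H] [CompleteSpace H]

omit [CompleteSpace H] in
/-- A weakly measurable function with values in a separable Hilbert space is measurable. -/
theorem aestronglyMeasurable_of_forall_inner [TopologicalSpace.SeparableSpace H] {ξ : α → H}
    (h : ∀ f : H, AEStronglyMeasurable (fun a => inner ℝ f (ξ a)) ν) :
    AEStronglyMeasurable ξ ν := by
  set d := TopologicalSpace.denseSeq H
  -- Projections on these increasing finite-dimensional spaces involve only finitely many inner
  -- products with `ξ`, and they converge pointwise to the identity.
  set U : ℕ → Submodule ℝ H := fun n => Submodule.span ℝ (d '' Set.Iio n) with hU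
  have hfin : ∀ n, FiniteDimensional ℝ (U n) := fun n =>
    FiniteDimensional.span_of_finite ℝ ((Set.finite_Iio n).image d)
  have hmono : Monotone U := fun n n' hn =>
    Submodule.span_mono (Set.image_mono (Set.Iio_subset_Iio hn))
  have hdense : ⊤ ≤ (⨆ n, U n).topologicalClosure := by
    intro x _
    refine closure_mono ?_ (TopologicalSpace.denseRange_denseSeq H x)
    rintro _ ⟨n, rfl⟩
    exact Submodule.mem_iSup_of_mem (n + 1)
      (Submodule.subset_span ⟨n, Set.mem_Iio.2 (Nat.lt_succ_self n), rfl⟩)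
  refine aestronglyMeasurable_of_tendsto_ae (f := fun n a => (U n).starProjection (ξ a))
    Filter.atTop (fun n => ?_) (Filter.Eventually.of_forall fun a =>
      Submodule.starProjection_tendsto_self U hmono (ξ a) hdense)
  have hsum : (fun a => (U n).starProjection (ξ a)) = fun a =>
      ∑ i, inner ℝ ((stdOrthonormalBasis ℝ (U n) i : U n) : H) (ξ a) •
        ((stdOrthonormalBasis ℝ (U n) i : U n) : H) := by
    ext a
    rw [(stdOrthonormalBasis ℝ (U n)).starProjection_eq_sum_rankOne]
    simp
  rw [hsum]
  exact Finset.aestronglyMeasurable_fun_sum _ fun i _ => (h _).smul_const _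

/-- Evaluations are inner products with kernel sections, whose span is dense; limits give weak
measurability. -/
theorem aestronglyMeasurable_of_forall_apply {𝓩 : Type*} [RKHS ℝ H 𝓩 ℝ]
    [TopologicalSpace.SeparableSpace H] {ξ : α → H}
    (h : ∀ z : 𝓩, AEStronglyMeasurable (fun a => ξ a z) ν) : AEStronglyMeasurable ξ ν := by
  refine aestronglyMeasurable_of_forall_inner fun f => ?_
  have hf : f ∈ (Submodule.span ℝ {RKHS.kerFun H z c | (z : 𝓩) (c : ℝ)}).topologicalClosure := by
    rw [RKHS.kerFun_dense]
    trivial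
  obtain ⟨s, hs, hsf⟩ := mem_closure_iff_seq_limit.1 hf
  refine aestronglyMeasurable_of_tendsto_ae (f := fun n a => inner ℝ (s n) (ξ a))
    Filter.atTop (fun n => ?_) (Filter.Eventually.of_forall fun a =>
      hsf.inner tendsto_const_nhds)
  refine Submodule.span_induction (p := fun g _ =>
    AEStronglyMeasurable (fun a => inner ℝ g (ξ a)) ν) ?_ ?_ ?_ ?_ (hs n)
  · rintro _ ⟨z, c, rfl⟩
    simp only [RKHS.kerFun_inner]
    exact aestronglyMeasurable_const.inner (h z)
  · simpa using aestronglyMeasurable_const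
  · intro f g _ _ h1 h2
    simp only [inner_add_left]
    exact h1.add h2
  · intro c g _ h1
    simp only [inner_smul_left]
    exact h1.const_mul _

end Measurability

/-! ### Kernel operators, tensor squares and the normal equation. -/

section KernelOperators

open scoped TensorProduct

/-- Cauchy–Schwarz over the index set; with `a i = f (z i)` it yields the form inequality `A² ≤ κ²
A` for the empirical operator. -/
theorem norm_sum_smul_sq_le {ι : Type*} [Fintype ι] {H : Type*} [NormedAddCommGroup H]
    [InnerProductSpace ℝ H] {κ : ℝ} {k : ι → H} (hk : ∀ i, ‖k i‖ ≤ κ) (a : ι → ℝ) :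
    ‖∑ i, a i • k i‖ ^ 2 ≤ Fintype.card ι * (κ ^ 2 * ∑ i, a i ^ 2) := by
  have h1 : ‖∑ i, a i • k i‖ ≤ ∑ i, |a i| * κ := norm_sum_le_of_le _ fun i _ => by
    rw [norm_smul, Real.norm_eq_abs]
    exact mul_le_mul_of_nonneg_left (hk i) (abs_nonneg _)
  calc ‖∑ i, a i • k i‖ ^ 2 ≤ (∑ i, |a i| * κ) ^ 2 := by gcongr
    _ ≤ Fintype.card ι * ∑ i, (|a i| * κ) ^ 2 := sq_sum_le_card_mul_sum_sq
    _ = _ := by simp [mul_pow, Finset.mul_sum, mul_comm]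

section Tensor

variable {H : Type*} [NormedAddCommGroup H] [InnerProductSpace ℝ H]

/-- The tensor square `x ⊗ x`, in the Hilbert space completion of the algebraic tensor product. -/
noncomputable def tensorSquare (x : H) : UniformSpace.Completion (H ⊗[ℝ] H) :=
  ((x ⊗ₜ[ℝ] x : H ⊗[ℝ] H) : UniformSpace.Completion (H ⊗[ℝ] H))

theorem norm_tensorSquare (x : H) : ‖tensorSquare x‖ = ‖x‖ ^ 2 := by
  rw [tensorSquare, UniformSpace.Completion.norm_coe, TensorProduct.norm_tmul, sq]

theorem inner_tensorSquare (x f g : H) :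
    inner ℝ (tensorSquare x) ((f ⊗ₜ[ℝ] g : H ⊗[ℝ] H) : UniformSpace.Completion (H ⊗[ℝ] H)) =
      inner ℝ x f * inner ℝ x g := by
  rw [tensorSquare, UniformSpace.Completion.inner_coe, TensorProduct.inner_tmul]

theorem continuous_tensorSquare : Continuous (tensorSquare : H → _) :=
  (UniformSpace.Completion.continuous_coe _).comp
    (TensorProduct.continuous_tmul.comp (continuous_id.prodMk continuous_id))

/-- The operator norm is at most the Hilbert–Schmidt norm. -/
theorem opNorm_le_of_inner_eq {T : H →L[ℝ] H} {Ψ : UniformSpace.Completion (H ⊗[ℝ] H)}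
    (h : ∀ f g, inner ℝ (T f) g =
      inner ℝ Ψ ((f ⊗ₜ[ℝ] g : H ⊗[ℝ] H) : UniformSpace.Completion (H ⊗[ℝ] H))) : ‖T‖ ≤ ‖Ψ‖ := by
  refine ContinuousLinearMap.opNorm_le_bound _ (norm_nonneg _) fun f => ?_
  -- Testing against `f ⊗ T f` produces `‖T f‖²` on the left.
  have h1 := real_inner_le_norm Ψ
    ((f ⊗ₜ[ℝ] T f : H ⊗[ℝ] H) : UniformSpace.Completion (H ⊗[ℝ] H))
  rw [← h, real_inner_self_eq_norm_sq, UniformSpace.Completion.norm_coe,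
    TensorProduct.norm_tmul] at h1
  rcases (norm_nonneg (T f)).eq_or_lt with h2 | h2
  · rw [← h2]; positivity
  · refine le_of_mul_le_mul_right ?_ h2
    calc ‖T f‖ * ‖T f‖ = ‖T f‖ ^ 2 := (sq _).symm
      _ ≤ _ := h1
      _ = _ := by ring

end Tensor

/-- The normal equation of the best approximation. -/
theorem IsMinNormSolution.inner_eq_zero {H E : Type*} [NormedAddCommGroup H]
    [InnerProductSpace ℝ H] [NormedAddCommGroup E] [InnerProductSpace ℝ E] {I : H →L[ℝ] E}
    {y : E} {f : H} (hf : IsMinNormSolution I y f)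
    (g : H) : inner ℝ (I f - y) (I g) = 0 := by
  by_contra hne
  set a := inner ℝ (I f - y) (I g) with ha
  have h1 : ∀ t : ℝ, 0 ≤ 2 * (t * a) + t ^ 2 * ‖I g‖ ^ 2 := fun t => by
    have h2 := hf.1 (f + t • g)
    rw [map_add, map_smul, add_sub_right_comm] at h2
    have h3 : ‖I f - y‖ ^ 2 ≤ ‖I f - y + t • I g‖ ^ 2 := by gcongr
    rw [norm_add_sq_real, real_inner_smul_right, norm_smul, mul_pow, Real.norm_eq_abs,
      sq_abs] at h3
    linarith
  have h4 : 0 < ‖I g‖ ^ 2 + 1 := by positivity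
  -- Near the minimiser of the quadratic; the `+ 1` avoids a case distinction at `I g = 0`.
  have h5 := h1 (-a / (‖I g‖ ^ 2 + 1))
  have h6 : 2 * (-a / (‖I g‖ ^ 2 + 1) * a) + (-a / (‖I g‖ ^ 2 + 1)) ^ 2 * ‖I g‖ ^ 2 =
      -(a ^ 2 * (‖I g‖ ^ 2 + 2)) / (‖I g‖ ^ 2 + 1) ^ 2 := by
    field_simp
    ring
  rw [h6] at h5
  have h7 : 0 < a ^ 2 * (‖I g‖ ^ 2 + 2) / (‖I g‖ ^ 2 + 1) ^ 2 := by positivity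
  rw [neg_div] at h5
  linarith

namespace BoundedKernel

variable {𝓩 : Type*} [MeasurableSpace 𝓩] {H : Type*} [NormedAddCommGroup H]
  [InnerProductSpace ℝ H] [CompleteSpace H] [RKHS ℝ H 𝓩 ℝ] {μ : Measure 𝓩} {κ : ℝ}

theorem norm_kernelSection_le (h : BoundedKernel H μ κ) (z : 𝓩) : ‖kernelSection H z‖ ≤ κ := by
  refine le_of_sq_le_sq ?_ h.pos.le
  rw [← real_inner_self_eq_norm_sq, inner_kernelSection, kernelSection_apply]
  exact h.le z z

/-- By symmetry of the kernel, evaluating the section at a fixed point gives a function in `H`,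
measurable because `H ⊆ L²`. -/
theorem aestronglyMeasurable_kernelSection (h : BoundedKernel H μ κ) :
    AEStronglyMeasurable (kernelSection H) μ := by
  have := h.separable
  refine aestronglyMeasurable_of_forall_apply fun z => ?_
  have h1 : (fun z' => kernelSection H z' z) = fun z' => kernelSection H z z' := by
    ext z'
    rw [kernelSection_apply, kernelSection_apply, h.symm]
  rw [h1]
  exact (h.memLp (kernelSection H z)).aestronglyMeasurable

theorem aestronglyMeasurable_tensorSquare (h : BoundedKernel H μ κ) :
    AEStronglyMeasurable (fun z => tensorSquare (kernelSection H z)) μ :=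
  continuous_tensorSquare.comp_aestronglyMeasurable h.aestronglyMeasurable_kernelSection

theorem norm_tensorSquare_le (h : BoundedKernel H μ κ) (z : 𝓩) :
    ‖tensorSquare (kernelSection H z)‖ ≤ κ ^ 2 := by
  rw [norm_tensorSquare]
  have := h.norm_kernelSection_le z
  gcongr

theorem isPosBounded_empiricalOperator (h : BoundedKernel H μ κ) {N : ℕ} (z : Fin N → 𝓩) :
    IsPosBounded (empiricalOperator H z) (κ ^ 2) := by
  have hin : ∀ f g : H, inner ℝ (empiricalOperator H z f) g =
      (N : ℝ)⁻¹ * ∑ i, f (z i) * g (z i) := fun f g => by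
    simp [empiricalOperator_apply, real_inner_smul_left, sum_inner, inner_kernelSection]
  refine ⟨fun f g => ?_, fun f => ?_⟩
  · rw [hin, real_inner_comm, hin]
    simp_rw [mul_comm]
  · rw [hin, empiricalOperator_apply, norm_smul, mul_pow, Real.norm_eq_abs, sq_abs]
    have h1 := norm_sum_smul_sq_le (fun i => h.norm_kernelSection_le (z i)) fun i => f (z i)
    rw [Fintype.card_fin] at h1
    rcases Nat.eq_zero_or_pos N with rfl | hN
    · simp
    have hN' : (0 : ℝ) < N := Nat.cast_pos.2 hN
    calc _ ≤ ((N : ℝ)⁻¹) ^ 2 * (N * (κ ^ 2 * ∑ i, f (z i) ^ 2)) := by gcongr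
      _ = _ := by simp_rw [← sq]; field_simp

omit [MeasurableSpace 𝓩] in
theorem _root_.isCompactOperator_empiricalOperator {N : ℕ} (z : Fin N → 𝓩) :
    IsCompactOperator (empiricalOperator H z) := by
  change empiricalOperator H z ∈ compactOperator (RingHom.id ℝ) H H
  refine Submodule.smul_mem _ _ (Submodule.sum_mem _ fun i _ => ?_)
  exact (isCompactOperator_of_locallyCompactSpace_rng
    (ContinuousLinearMap.toSpanSingleton ℝ (kernelSection H (z i)))).comp_clm
      (innerSL ℝ (kernelSection H (z i)))

variable [IsProbabilityMeasure μ]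

theorem inner_kernelOperatorH (h : BoundedKernel H μ κ) (f g : H) :
    inner ℝ (h.kernelOperatorH f) g = inner ℝ (h.inclusion f) (h.inclusion g) := by
  rw [kernelOperatorH, ContinuousLinearMap.comp_apply, kernelOperator,
    ContinuousLinearMap.adjoint_inner_left]

theorem norm_inclusion_sq (h : BoundedKernel H μ κ) (f : H) :
    ‖h.inclusion f‖ ^ 2 = inner ℝ (h.kernelOperatorH f) f := by
  rw [inner_kernelOperatorH, real_inner_self_eq_norm_sq]

theorem isPosBounded_kernelOperatorH (h : BoundedKernel H μ κ) :
    IsPosBounded h.kernelOperatorH (κ ^ 2) := by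
  refine ⟨fun f g => ?_, fun f => ?_⟩
  · rw [inner_kernelOperatorH, real_inner_comm _ f, inner_kernelOperatorH, real_inner_comm]
  · rw [← norm_inclusion_sq]
    have h1 : ‖h.kernelOperator‖ ≤ κ := by
      rw [kernelOperator, LinearIsometryEquiv.norm_map]
      exact LinearMap.mkContinuous_norm_le _ h.pos.le _
    have h2 : ‖h.kernelOperatorH f‖ ≤ κ * ‖h.inclusion f‖ :=
      (h.kernelOperator.le_opNorm _).trans
        (mul_le_mul_of_nonneg_right h1 (norm_nonneg _))
    calc _ ≤ (κ * ‖h.inclusion f‖) ^ 2 := by gcongr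
      _ = _ := by ring

theorem inner_integral_tensorSquare (h : BoundedKernel H μ κ) (f g : H) :
    inner ℝ (∫ z, tensorSquare (kernelSection H z) ∂μ)
      ((f ⊗ₜ[ℝ] g : H ⊗[ℝ] H) : UniformSpace.Completion (H ⊗[ℝ] H)) =
      inner ℝ (h.kernelOperatorH f) g := by
  have hi : Integrable (fun z => tensorSquare (kernelSection H z)) μ :=
    Integrable.of_bound h.aestronglyMeasurable_tensorSquare (κ ^ 2)
      (Filter.Eventually.of_forall h.norm_tensorSquare_le)
  rw [inner_kernelOperatorH, real_inner_comm, ← integral_inner hi, L2.inner_def]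
  refine integral_congr_ae ?_
  filter_upwards [h.inclusion_ae f, h.inclusion_ae g] with z hf hg
  rw [hf, hg, real_inner_comm, inner_tensorSquare, inner_kernelSection, inner_kernelSection]
  simp [mul_comm]

/-- The distance of the empirical kernel operator to its mean is bounded by that of the empirical
mean of the tensor squares. -/
theorem norm_empiricalOperator_sub_le (h : BoundedKernel H μ κ) {N : ℕ} (z : Fin N → 𝓩) :
    ‖empiricalOperator H z - h.kernelOperatorH‖ ≤
      ‖(N : ℝ)⁻¹ • ∑ i, tensorSquare (kernelSection H (z i)) -
        ∫ z, tensorSquare (kernelSection H z) ∂μ‖ := by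
  refine opNorm_le_of_inner_eq fun f g => ?_
  rw [inner_sub_left, h.inner_integral_tensorSquare, real_inner_smul_left, sum_inner, sub_apply,
    inner_sub_left, empiricalOperator_apply, real_inner_smul_left, sum_inner]
  simp only [inner_tensorSquare, inner_kernelSection, real_inner_smul_left]

section Mean

variable {𝓥 : Type*} [MeasurableSpace 𝓥] {μV : Measure 𝓥} [IsProbabilityMeasure μV]
  {fstar : 𝓩 → ℝ} {T : Lp ℝ 2 μ →ₗ[ℝ] Lp ℝ 1 μV} {T₂k : 𝓥 → H} {C : ℝ}

omit [IsProbabilityMeasure μV] in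
theorem aestronglyMeasurable_of_version (h : BoundedKernel H μ κ)
    (hT₂k : ∀ z : 𝓩, (fun v => T₂k v z) =ᵐ[μV] T (h.inclusion (kernelSection H z))) :
    AEStronglyMeasurable T₂k μV := by
  have := h.separable
  exact aestronglyMeasurable_of_forall_apply fun z =>
    (Lp.aestronglyMeasurable _).congr (hT₂k z).symm

/-- The mean of `T₂k` is `𝓛 f_*`, which is `𝓛 f` for the best approximation `f`. -/
theorem integral_eq_kernelOperatorH (h : BoundedKernel H μ κ) (hA1 : MemLp fstar 2 μ)
    (hA3 : ∀ f : Lp ℝ 2 μ, ∫ z, f z * fstar z ∂μ = ∫ v, T f v ∂μV)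
    (hT₂k : ∀ z : 𝓩, (fun v => T₂k v z) =ᵐ[μV] T (h.inclusion (kernelSection H z)))
    (hA4 : ∀ v : 𝓥, ‖T₂k v‖ ≤ C) {fH : H}
    (hfH : IsMinNormSolution h.inclusion (hA1.toLp fstar) fH) :
    ∫ v, T₂k v ∂μV = h.kernelOperatorH fH := by
  have hi : Integrable T₂k μV := Integrable.of_bound (h.aestronglyMeasurable_of_version hT₂k) C
    (Filter.Eventually.of_forall hA4)
  refine DFunLike.ext _ _ fun z => ?_
  have h1 : (∫ v, T₂k v ∂μV) z = ∫ v, T₂k v z ∂μV := by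
    rw [← inner_kernelSection, ← integral_inner hi]
    simp only [inner_kernelSection]
  have h2 := hfH.inner_eq_zero (kernelSection H z)
  rw [inner_sub_left, sub_eq_zero, real_inner_comm, real_inner_comm _ (hA1.toLp fstar)] at h2
  rw [h1, integral_congr_ae (hT₂k z), ← hA3, ← inner_kernelSection, real_inner_comm,
    inner_kernelOperatorH, real_inner_comm, h2, L2.inner_def]
  refine integral_congr_ae ?_
  filter_upwards [hA1.coeFn_toLp] with z' hz'
  rw [hz']
  simp [mul_comm]

end Mean

end BoundedKernel

end KernelOperators

/-! ### Combination of the deterministic and probabilistic parts. -/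

section Assembly

/-- The failure set may be non-measurable; the event is the complement of its measurable hull. -/
theorem withProbAtLeast_of_measure_le {Ω : Type*} [MeasurableSpace Ω] {P : Measure Ω}
    [IsProbabilityMeasure P] {η : ℝ} (hη : 0 ≤ η) {Q : Ω → Prop}
    (h : P {ω | ¬ Q ω} ≤ ENNReal.ofReal η) : WithProbAtLeast P (1 - η) Q := by
  refine ⟨(toMeasurable P {ω | ¬ Q ω})ᶜ, (measurableSet_toMeasurable _ _).compl, ?_,
    fun ω hω => ?_⟩
  · rw [prob_compl_eq_one_sub (measurableSet_toMeasurable _ _), measure_toMeasurable,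
      ENNReal.ofReal_sub _ hη, ENNReal.ofReal_one]
    exact tsub_le_tsub_left h 1
  · by_contra hQ
    exact hω (subset_toMeasurable _ _ hQ)

theorem one_le_log_four_div {η : ℝ} (h0 : 0 < η) (h1 : η < 1) : 1 ≤ Real.log (4 / η) := by
  rw [Real.le_log_iff_exp_le (by positivity), le_div_iff₀ h0]
  have := Real.exp_one_lt_d9
  have := Real.exp_pos 1
  nlinarith

theorem six_mul_exp_neg_two_mul_log_le {η : ℝ} (h0 : 0 < η) (h1 : η < 1) :
    6 * Real.exp (-(2 * Real.log (4 / η))) ≤ η := by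
  have h2 : Real.exp (-(2 * Real.log (4 / η))) = (η / 4) ^ 2 := by
    rw [← mul_neg, ← Real.log_inv, inv_div, ← Nat.cast_ofNat (R := ℝ) (n := 2), ← Real.log_pow,
      Real.exp_log (by positivity)]
  rw [h2]
  nlinarith

theorem sum_productSample {𝓧 𝓤 𝓩 E : Type*} [AddCommMonoid E] {n m : ℕ} (pair : 𝓧 × 𝓤 → 𝓩)
    (x : Fin n → 𝓧) (u : Fin m → 𝓤) (X : 𝓩 → E) :
    ∑ i, X (productSample pair x u i) = ∑ i, ∑ j, X (pair (x i, u j)) := by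
  rw [← Fintype.sum_prod_type' (f := fun i j => X (pair (x i, u j))),
    ← finProdFinEquiv.symm.sum_comp]
  rfl

variable {𝓥 𝓩 H : Type*} [MeasurableSpace 𝓩] [NormedAddCommGroup H]
  [InnerProductSpace ℝ H] [CompleteSpace H] [RKHS ℝ H 𝓩 ℝ]

/-- The error bounds hold on the event where the empirical quantities are close to their means. -/
theorem BoundedKernel.exists_errorBounds {μ : Measure 𝓩} [IsProbabilityMeasure μ] {κ : ℝ}
    (h : BoundedKernel H μ κ) (T₂k : 𝓥 → H) {C : ℝ} (hC : 0 < C) {fH w : H} {r : ℝ} (hr : 0 < r)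
    (hA5 : fH = spectralApply h.kernelOperatorH (fun σ => σ ^ r) w)
    {g : ℝ → ℝ → ℝ} (hg : IsRegulariser κ g) {rbar : EReal} (hrbar : IsQualification κ g rbar) :
    ∃ C₁ C₂ : ℝ, ∀ n m : ℕ, 0 < n → 0 < m → ∀ η : ℝ, 0 < η → η < 1 →
      ∀ lam : ℝ, lam = (1 / √(n : ℝ) + 1 / √(m : ℝ)) ^ (1 / (r + 1)) → lam ≤ κ ^ 2 →
      6 * κ ^ 2 * Real.log (4 / η) < lam ^ (-r) → ∀ (N : ℕ) (v : Fin n → 𝓥) (z : Fin N → 𝓩),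
      ‖empiricalOperator H z - h.kernelOperatorH‖ ≤
        6 * κ ^ 2 * Real.log (4 / η) * (1 / √(n : ℝ) + 1 / √(m : ℝ)) →
      ‖(n : ℝ)⁻¹ • ∑ i, T₂k (v i) - h.kernelOperatorH fH‖ ≤
        6 * C * Real.log (4 / η) * (1 / √(n : ℝ) + 1 / √(m : ℝ)) →
      ErrorBounds h.inclusion r rbar C₁ C₂ n m η (grsEstimator g T₂k lam v z) fH := by
  have hκ := h.pos
  set a : ℝ := 6 * (C + κ ^ 2) with ha
  have ha0 : 0 < a := by positivity
  -- The constants must be fixed before knowing which bound applies; when the qualification is too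
  -- small the value is irrelevant.
  obtain ⟨C₁, h₁⟩ : ∃ C₁ : ℝ, (r : EReal) ≤ rbar → ∀ lam : ℝ, 0 < lam → lam ≤ κ ^ 2 →
      ∀ ℓ : ℝ, 1 ≤ ℓ → ∀ (A : H →L[ℝ] H) (b : H), IsPosBounded A (κ ^ 2) → IsCompactOperator A →
      ‖A - h.kernelOperatorH‖ ≤ a * (lam ^ r * lam) * ℓ →
      ‖b - h.kernelOperatorH fH‖ ≤ a * (lam ^ r * lam) * ℓ →
      ‖spectralApply A (g lam) b - fH‖ ≤ C₁ * lam ^ r * ℓ := by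
    by_cases hrr : (r : EReal) ≤ rbar
    · obtain ⟨C₁, h₁⟩ := exists_norm_error_bound hκ h.isPosBounded_kernelOperatorH hr hA5 hg
        hrbar hrr ha0
      exact ⟨C₁, fun _ => h₁⟩
    · exact ⟨0, fun h' => absurd h' hrr⟩
  obtain ⟨C₂, h₂⟩ : ∃ C₂ : ℝ, ((r + 1 / 2 : ℝ) : EReal) ≤ rbar → ∀ lam : ℝ, 0 < lam →
      lam ≤ κ ^ 2 → ∀ ℓ : ℝ, 1 ≤ ℓ → ∀ (A : H →L[ℝ] H) (b : H),
      IsPosBounded A (κ ^ 2) → IsCompactOperator A → ‖A - h.kernelOperatorH‖ ≤ 1 * lam →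
      ‖A - h.kernelOperatorH‖ ≤ a * (lam ^ r * lam) * ℓ →
      ‖b - h.kernelOperatorH fH‖ ≤ a * (lam ^ r * lam) * ℓ →
      ‖h.inclusion (spectralApply A (g lam) b - fH)‖ ≤ C₂ * (lam ^ r * √lam) * ℓ := by
    by_cases hrr : ((r + 1 / 2 : ℝ) : EReal) ≤ rbar
    · obtain ⟨C₂, h₂⟩ := exists_norm_apply_error_bound hκ h.isPosBounded_kernelOperatorH
        h.norm_inclusion_sq hr hA5 hg hrbar hrr ha0 one_pos
      exact ⟨C₂, fun _ => h₂⟩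
    · exact ⟨0, fun h' => absurd h' hrr⟩
  refine ⟨C₁, C₂, fun n m hn hm η hη0 hη1 lam hlam hlam1 hlam2 N v z hz hv => ?_⟩
  set t : ℝ := 1 / √(n : ℝ) + 1 / √(m : ℝ) with ht
  have hn' : (0 : ℝ) < n := Nat.cast_pos.2 hn
  have hm' : (0 : ℝ) < m := Nat.cast_pos.2 hm
  have ht0 : 0 < t := by positivity
  have hlam0 : 0 < lam := by rw [hlam]; positivity
  have hr1 : r + 1 ≠ 0 := by positivity
  have hpow : ∀ s : ℝ, lam ^ s = t ^ (s / (r + 1)) := fun s => by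
    rw [hlam, ← Real.rpow_mul ht0.le, one_div_mul_eq_div]
  have hlamt : lam ^ r * lam = t := by
    rw [← Real.rpow_add_one hlam0.ne', hpow, div_self hr1, Real.rpow_one]
  have hlamt' : lam ^ r * √lam = t ^ ((2 * r + 1) / (2 * r + 2)) := by
    rw [Real.sqrt_eq_rpow, ← Real.rpow_add hlam0, hpow]
    congr 1
    field_simp
  set ℓ := Real.log (4 / η) with hℓ
  have hℓ1 : 1 ≤ ℓ := one_le_log_four_div hη0 hη1
  have hA := h.isPosBounded_empiricalOperator z
  have hAc := isCompactOperator_empiricalOperator (H := H) z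
  have hz1 : ‖empiricalOperator H z - h.kernelOperatorH‖ ≤ a * (lam ^ r * lam) * ℓ := by
    rw [hlamt]
    refine hz.trans ?_
    have : 0 ≤ C * (ℓ * t) := by positivity
    rw [ha]
    nlinarith
  have hv1 : ‖(n : ℝ)⁻¹ • ∑ i, T₂k (v i) - h.kernelOperatorH fH‖ ≤ a * (lam ^ r * lam) * ℓ := by
    rw [hlamt]
    refine hv.trans ?_
    have : 0 ≤ κ ^ 2 * (ℓ * t) := by positivity
    rw [ha]
    nlinarith
  -- The assumption on `lam ^ (-r)` absorbs the logarithm: `6 κ² ℓ t ≤ lam ^ (-r) t = lam`.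
  have hz2 : ‖empiricalOperator H z - h.kernelOperatorH‖ ≤ 1 * lam := by
    refine hz.trans ?_
    calc 6 * κ ^ 2 * ℓ * t ≤ lam ^ (-r) * t := by gcongr
      _ = lam ^ (-r) * lam ^ r * lam := by rw [← hlamt]; ring
      _ = 1 * lam := by rw [← Real.rpow_add hlam0, neg_add_cancel, Real.rpow_zero]
  refine ⟨fun hrr => ?_, fun hrr => ?_⟩
  · have h3 := h₁ hrr lam hlam0 hlam1 ℓ hℓ1 _ _ hA hAc hz1 hv1
    rwa [hpow] at h3
  · have h3 := h₂ hrr lam hlam0 hlam1 ℓ hℓ1 _ _ hA hAc hz2 hz1 hv1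
    rwa [hlamt'] at h3

/-- A union bound, so the `z_i` may depend on the `v_i`; the total is `6 (η / 4)² ≤ η`. -/
theorem withProbAtLeast_of_tails {Ω : Type*} [MeasurableSpace Ω] {P : Measure Ω}
    [IsProbabilityMeasure P] {η : ℝ} (h0 : 0 < η) (h1 : η < 1) {Q : Ω → Prop} {S₁ S₂ : Set Ω}
    (hS₁ : P S₁ ≤ ENNReal.ofReal (2 * Real.exp (-(2 * Real.log (4 / η)))))
    (hS₂ : P S₂ ≤ ENNReal.ofReal (4 * Real.exp (-(2 * Real.log (4 / η)))))
    (hQ : ∀ ω, ω ∉ S₁ → ω ∉ S₂ → Q ω) : WithProbAtLeast P (1 - η) Q := by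
  refine withProbAtLeast_of_measure_le h0.le ?_
  calc P {ω | ¬ Q ω} ≤ P (S₁ ∪ S₂) := measure_mono fun ω hω => by
        by_contra hcon
        rw [Set.mem_union, not_or] at hcon
        exact hω (hQ ω hcon.1 hcon.2)
    _ ≤ _ := (measure_union_le _ _).trans (add_le_add hS₁ hS₂)
    _ = ENNReal.ofReal (6 * Real.exp (-(2 * Real.log (4 / η)))) := by
      rw [← ENNReal.ofReal_add (by positivity) (by positivity)]
      ring_nf
    _ ≤ _ := ENNReal.ofReal_le_ofReal (six_mul_exp_neg_two_mul_log_le h0 h1)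

end Assembly

theorem theorem1 {𝓥 𝓩 H : Type*} [MeasurableSpace 𝓥] [MeasurableSpace 𝓩]
    [NormedAddCommGroup H] [InnerProductSpace ℝ H] [CompleteSpace H] [RKHS ℝ H 𝓩 ℝ]
    -- the laws of `V` and `Z`
    (μV : Measure 𝓥) [IsProbabilityMeasure μV] (μZ : Measure 𝓩) [IsProbabilityMeasure μZ]
    -- (A1), (A2)
    (fstar : 𝓩 → ℝ) (hA1 : MemLp fstar 2 μZ)
    (κ : ℝ) (hA2 : BoundedKernel H μZ κ)
    -- (A3)
    (T : Lp ℝ 2 μZ →ₗ[ℝ] Lp ℝ 1 μV)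
    (hA3 : ∀ f : Lp ℝ 2 μZ, ∫ z, f z * fstar z ∂μZ = ∫ v, T f v ∂μV)
    -- (A4), for a pointwise version `T₂k v z` of `T[k(z, ·)](v)`
    (T₂k : 𝓥 → H)
    (hT₂k : ∀ z : 𝓩, (fun v => T₂k v z) =ᵐ[μV] T (hA2.inclusion (kernelSection H z)))
    (C : ℝ) (hC : 0 < C) (hA4 : ∀ v : 𝓥, ‖T₂k v‖ ≤ C)
    -- the best approximation `f_H`, and (A5)
    (fH : H) (hfH : IsMinNormSolution hA2.inclusion (hA1.toLp fstar) fH)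
    (r : ℝ) (hr : 0 < r) (w : H)
    (hA5 : fH = spectralApply hA2.kernelOperatorH (fun σ => σ ^ r) w)
    -- the regulariser and its qualification
    (g : ℝ → ℝ → ℝ) (hg : IsRegulariser κ g)
    (rbar : EReal) (hrbar : IsQualification κ g rbar) :
    ∃ C₁ C₂ : ℝ, ∀ n m : ℕ, 0 < n → 0 < m → ∀ η : ℝ, 0 < η → η < 1 →
      ∀ lam : ℝ, lam = (1 / √(n : ℝ) + 1 / √(m : ℝ)) ^ (1 / (r + 1)) → lam ≤ κ ^ 2 →
      6 * κ ^ 2 * Real.log (4 / η) < lam ^ (-r) →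
      -- (S1)
      (∀ {Ω : Type*} [MeasurableSpace Ω] (P : Measure Ω) [IsProbabilityMeasure P]
        (v : Fin n → Ω → 𝓥) (z : Fin m → Ω → 𝓩),
        IsIIDSample P μV v → IsIIDSample P μZ z →
        WithProbAtLeast P (1 - η) fun ω =>
          ErrorBounds hA2.inclusion r rbar C₁ C₂ n m η
            (grsEstimator g T₂k lam (fun i => v i ω) (fun i => z i ω)) fH) ∧
      -- (S2)
      (∀ {Ω 𝓧 𝓤 : Type*} [MeasurableSpace Ω] [MeasurableSpace 𝓧] [MeasurableSpace 𝓤]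
        (P : Measure Ω) [IsProbabilityMeasure P]
        (μX : Measure 𝓧) [IsProbabilityMeasure μX] (μU : Measure 𝓤) [IsProbabilityMeasure μU]
        (pair : 𝓧 × 𝓤 → 𝓩) (v : Fin n → Ω → 𝓥) (x : Fin n → Ω → 𝓧) (u : Fin m → Ω → 𝓤),
        Measurable pair → μZ = (μX.prod μU).map pair →
        IsIIDSample P μV v → IsIIDSample P μX x → IsIIDSample P μU u →
        IndepFun (fun ω i => x i ω) (fun ω j => u j ω) P →
        WithProbAtLeast P (1 - η) fun ω =>
          ErrorBounds hA2.inclusion r rbar C₁ C₂ n m η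
            (grsEstimator g T₂k lam (fun i => v i ω)
              (productSample pair (fun i => x i ω) (fun j => u j ω))) fH) := by
  obtain ⟨C₁, C₂, hbound⟩ := hA2.exists_errorBounds T₂k hC hr hA5 hg hrbar
  have hmean := hA2.integral_eq_kernelOperatorH hA1 hA3 hT₂k hA4 hfH
  have hT₂m := hA2.aestronglyMeasurable_of_version hT₂k
  have hκ2 : 0 < κ ^ 2 := by have := hA2.pos; positivity
  refine ⟨C₁, C₂, fun n m hn hm η hη0 hη1 lam hlam hlam1 hlam2 => ?_⟩
  have hℓ := one_le_log_four_div hη0 hη1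
  have hb := hbound n m hn hm η hη0 hη1 lam hlam hlam1 hlam2
  set ℓ := Real.log (4 / η)
  have hv_le : 6 * C * ℓ / √(n : ℝ) ≤ 6 * C * ℓ * (1 / √(n : ℝ) + 1 / √(m : ℝ)) := by
    rw [div_eq_mul_one_div]
    gcongr
    exact le_add_of_nonneg_right (by positivity)
  refine ⟨fun {Ω} _ P _ v z hv hz => ?_,
    fun {Ω 𝓧 𝓤} _ _ _ P _ μX _ μU _ pair v x u hpair hμZ hv hx hu hxu => ?_⟩
  · refine withProbAtLeast_of_tails hη0 hη1
      (hv.norm_mean_sub_integral_tail hT₂m hC hA4 hn hℓ)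
      ((hz.norm_mean_sub_integral_tail hA2.aestronglyMeasurable_tensorSquare hκ2
        hA2.norm_tensorSquare_le hm hℓ).trans (ENNReal.ofReal_le_ofReal ?_)) fun ω h1 h2 => ?_
    · have := Real.exp_pos (-(2 * ℓ))
      linarith
    rw [Set.mem_ofPred_eq, not_lt] at h1 h2
    rw [hmean] at h1
    refine hb _ _ _ ((hA2.norm_empiricalOperator_sub_le _).trans (h2.trans ?_)) (h1.trans hv_le)
    rw [div_eq_mul_one_div]
    gcongr
    exact le_add_of_nonneg_left (by positivity)
  · have hX : AEStronglyMeasurable (fun p => tensorSquare (kernelSection H (pair p)))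
        (μX.prod μU) := by
      have := hA2.aestronglyMeasurable_tensorSquare
      rw [hμZ] at this
      exact this.comp_measurable hpair
    -- The product law pushes forward to the law of `Z`, so the grid mean has the same expectation
    -- as in (S1).
    have hint : ∫ p, tensorSquare (kernelSection H (pair p)) ∂(μX.prod μU) =
        ∫ z, tensorSquare (kernelSection H z) ∂μZ := by
      have := hA2.aestronglyMeasurable_tensorSquare
      rw [hμZ] at this ⊢
      exact (integral_map hpair.aemeasurable this).symm
    refine withProbAtLeast_of_tails hη0 hη1
      (hv.norm_mean_sub_integral_tail hT₂m hC hA4 hn hℓ)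
      (hx.norm_grid_mean_sub_integral_tail hu hxu hX hκ2
        (fun p => hA2.norm_tensorSquare_le (pair p)) hn hm hℓ) fun ω h1 h2 => ?_
    rw [Set.mem_ofPred_eq, not_lt] at h1 h2
    rw [hmean] at h1
    refine hb _ _ _ ((hA2.norm_empiricalOperator_sub_le _).trans (le_trans (le_of_eq ?_) h2))
      (h1.trans hv_le)
    rw [sum_productSample pair _ _ fun z => tensorSquare (kernelSection H z), hint, Nat.cast_mul]
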